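/- Let $\mathbb{T}=\mathbb{R}/2\pi\mathbb{Z}$ and let $K=-\mathcal{H}\partial_u$ be the operator in $L^2(\mathbb{T})$ with Fourier symbol $|n|$, $n\in\mathbb{Z}$, and domain ${\rm Dom}(K)=H^1(\mathbb{T})$ (here $\mathcal{H}$ is the periodic Hilbert transform, with Fourier symbol $i\,{\rm sgn}(n)$). Let $c,A,B\in\mathbb{R}$ with $A>0$ and $B\neq 0$, let $\mu\in(2/3,2)$, and suppose that a real-valued $\eta\in{\rm Dom}(K)$ satisfies the deep-water Babenko equation $$ (c^2K-1)\eta-\eta K\eta-\tfrac12K\eta^2=0 \quad\text{almost everywhere on } \mathbb{T} $$ and has the local behavior $$ \eta(u)=\frac{c^2}{2}-A|u|^{2/3}-B|u|^{\mu}+o(|u|^{\mu})\quad\text{as } u\to0 . $$ Then $\mu$ is the second positive root of Grant's transcendental equation $$ \left(\mu+\frac23\right)\tan\left(\frac{\pi\mu}{2}+\frac{\pi}{3}\right)+\mu\tan\left(\frac{\pi\mu}{2}\right)+\frac{2}{\sqrt3}=0 , $$ that is, $2/3$ is the smallest positive root of this equation and $\mu$ is the smallest root greater than $2/3$. Numerically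 $\mu\approx1.469$, with $|\mu-1.469|<0.0005$. In particular $\mu\neq1$. -/

import Mathlib

open Real MeasureTheory AddCircle Asymptotics Filter Topology

instance instFactTwoPiPosCircle : Fact (0 < 2 * π) := ⟨Real.two_pi_pos⟩

/-- The `2π`-periodic domain, with its normalised Haar measure `haarAddCircle`. -/
abbrev Torus : Type := AddCircle (2 * π)

/-- The Fourier symbol `i sgn(n)` of the periodic Hilbert transform `H`. -/
noncomputable def hilbertSymbol (n : ℤ) : ℂ := Complex.I * (n.sign : ℂ)

/-- The Fourier symbol `i n` of the derivative `∂_u`. -/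
noncomputable def derivSymbol (n : ℤ) : ℂ := Complex.I * (n : ℂ)

/-- The Fourier symbol of the deep-water operator `K = -H ∂_u`. -/
noncomputable def deepWaterSymbol (n : ℤ) : ℂ := -(hilbertSymbol n * derivSymbol n)

/-- The symbol of `K` is `|n|`. -/
theorem deepWaterSymbol_eq (n : ℤ) : deepWaterSymbol n = ((|n| : ℤ) : ℂ) := by
  have h : deepWaterSymbol n = -(Complex.I * Complex.I) * ((n.sign * n : ℤ) : ℂ) := by
    simp only [deepWaterSymbol, hilbertSymbol, derivSymbol]
    push_cast
    ring
  rw [h, Complex.I_mul_I, Int.sign_mul_self_eq_abs]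
  simp

/-- `f` belongs to `Dom(K)`, a subspace of `L²(𝕋)`, and `K f = g` in `L²(𝕋)`, where `K` is the
operator with Fourier symbol `deepWaterSymbol`. Given `f`, such a `g` in `L²(𝕋)` exists iff
`∑ n² |f̂ₙ|² < ∞`, and it is unique up to null sets. -/
def IsDeepWaterImage (f g : Torus → ℝ) : Prop :=
  MemLp f 2 (haarAddCircle (T := 2 * π)) ∧ MemLp g 2 (haarAddCircle (T := 2 * π)) ∧
    ∀ n : ℤ, fourierCoeff (fun x : Torus => (g x : ℂ)) n =
      deepWaterSymbol n * fourierCoeff (fun x : Torus => (f x : ℂ)) n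

/-- `η ∈ Dom(K)` solves Babenko's equation in deep water with wave speed `c`,
`(c² K - 1) η - η K η - (1/2) K η² = 0`, almost everywhere. (`Dom(K)` is the Sobolev space
`H¹(𝕋)`, an algebra, so that `η²` is in `Dom(K)` as soon as `η` is.) -/
def IsBabenkoSolution (c : ℝ) (η : Torus → ℝ) : Prop :=
  ∃ Kη Kηsq : Torus → ℝ,
    IsDeepWaterImage η Kη ∧ IsDeepWaterImage (fun x => η x ^ 2) Kηsq ∧
      ∀ᵐ x ∂(haarAddCircle (T := 2 * π)),
        (c ^ 2 * Kη x - η x) - η x * Kη x - (1 / 2) * Kηsq x = 0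

/-- `μ` is a real root of Grant's equation; both tangents are required to be defined at `μ`. -/
def IsGrantRoot (μ : ℝ) : Prop :=
  Real.cos (π * μ / 2 + π / 3) ≠ 0 ∧ Real.cos (π * μ / 2) ≠ 0 ∧
    (μ + 2 / 3) * Real.tan (π * μ / 2 + π / 3) + μ * Real.tan (π * μ / 2) + 2 / √3 = 0

/-!
Put `φ = c² / 2 - η`. Babenko's equation becomes `φ K φ + K φ² / 2 = φ - c² / 2`. For a periodic
`u` let `G_u` (`dnExtension`) be the holomorphic function `∑_{n ≥ 1} 2 n ûₙ qⁿ` of the disc, whose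
boundary values have real part `K u`. The functions `a = 1 - G_φ` and `b = c² / 2 + G_{φ²} / 2`
then satisfy `b = φ ā` on the boundary, so that `a b = φ |a|²` is real there; having no negative
frequencies it is constant, and `a b = c² / 2` in the whole disc
(`sum_antidiagonal_eq_of_convolution`, `IsBabenkoSolution.mul_dnExtension_eq`).

Each factor is a linear integral transform, of `φ` respectively `φ²`, whose expansions at the
crest are `A |s|^{2/3} + B |s|^μ + o(|s|^μ)` and `A² |s|^{4/3} + 2 A B |s|^{μ+2/3} +
o(|s|^{μ+2/3})`. At the point `q = e^{-t}` a term `|s|^ν` produces `-ν t^{ν-1} / cos (π ν / 2)`: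
this is exact up to higher order for the explicit functions `((1 - q) (3 - q) / 2)^ν`
(`crestModel`), and a remainder `o(|s|^ν)` contributes only `o(t^{ν-1})`
(`isLittleO_integral_mul_kernel`), up to a constant in the real part when `ν > 1`. No regularity
of the remainder is needed. As `t → 0` the identity `a b = c² / 2` forces the constant terms of
the factors to vanish (that of `a` only for `μ > 1`, where it dominates the `μ` term) and then
relates the second coefficients of the two factors (`coefficient_relation`): `(μ + 2/3) cos (π μ /
2) = μ cos (π μ / 2 + π / 3)`, that is `3 μ cos (π μ / 2 - π / 3) + 2 cos (π μ / 2) = 0`. The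
exponent `μ = 1` is excluded separately, since a corner `B |s|` makes `a` contain a logarithm
(`not_isBigO_one_dnExtension_re`) while `a b = c² / 2` bounds `a` minus its leading term
(`first_factor_isBigO_one`).

Grant's equation multiplied by its two cosines is `2/3 cos (π μ / 2 + π / 6)` times the left-hand
side of the relation just found (`grantFactor`). The first factor gives the root `2/3`. The second
is positive on `(0, 1]`, strictly decreasing on `[1, 5/3]` and negative on `[5/3, 2)`, and it
changes sign between `1.4685` and `1.4695` (`grant_conclusion_of_grantFactor_eq_zero`).
-/

open scoped ComplexConjugate

/-! ### Fourier coefficients of products and the constant product -/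

theorem hasSum_of_eq {ι : Type*} {f g : ι → ℂ} {a : ℂ} (hf : HasSum f a) (h : ∀ k, f k = g k) :
    HasSum g a :=
  funext h ▸ hf

theorem summable_sq_fourierCoeff_of_memLp {f : Torus → ℂ}
    (hf : MemLp f 2 (haarAddCircle (T := 2 * π))) :
    Summable fun n : ℤ => ‖fourierCoeff f n‖ ^ 2 := by
  have h := (hasSum_sq_fourierCoeff (hf.toLp f)).summable
  simpa only [fourierCoeff_congr_ae hf.coeFn_toLp] using h

/-- Parseval's identity in convolution form: the Fourier coefficients of a product of two
square-integrable functions. -/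
theorem hasSum_fourierCoeff_mul {f g : Torus → ℂ}
    (hf : MemLp f 2 (haarAddCircle (T := 2 * π)))
    (hg : MemLp g 2 (haarAddCircle (T := 2 * π))) (n : ℤ) :
    HasSum (fun k : ℤ => fourierCoeff f k * fourierCoeff g (n - k))
      (fourierCoeff (fun x => f x * g x) n) := by
  have hG : MemLp (fun x => conj (g x) * fourier n x) 2 (haarAddCircle (T := 2 * π)) := by
    refine MemLp.of_le hg ?_ ?_
    · exact (hg.1.star).mul (map_continuous (fourier n)).aestronglyMeasurable
    · filter_upwards with x
      simp [fourier_apply, Circle.norm_coe]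
  have h := (fourierBasis (T := 2 * π)).hasSum_inner_mul_inner (hG.toLp _) (hf.toLp f)
  have e1 (k : ℤ) : inner ℂ (fourierBasis (T := 2 * π) k) (hf.toLp f) = fourierCoeff f k := by
    rw [← (fourierBasis (T := 2 * π)).repr_apply_apply, fourierBasis_repr,
      fourierCoeff_congr_ae hf.coeFn_toLp]
  have e2 (k : ℤ) : inner ℂ (hG.toLp _) (fourierBasis (T := 2 * π) k) =
      fourierCoeff g (n - k) := by
    rw [← inner_conj_symm, ← (fourierBasis (T := 2 * π)).repr_apply_apply, fourierBasis_repr,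
      fourierCoeff_congr_ae hG.coeFn_toLp]
    simp only [fourierCoeff, ← integral_conj]
    refine integral_congr_ae (Eventually.of_forall fun x => ?_)
    have : fourier (-(n - k)) x = conj (fourier (-k) x * fourier n x) := by
      rw [← fourier_add, ← fourier_neg]
      ring_nf
    simp only [smul_eq_mul, this, map_mul, Complex.conj_conj]
    ring
  have e3 : inner ℂ (hG.toLp _) (hf.toLp f) = fourierCoeff (fun x => f x * g x) n := by
    rw [L2.inner_def, fourierCoeff]
    refine integral_congr_ae ?_
    filter_upwards [hG.coeFn_toLp, hf.coeFn_toLp] with x h1 h2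
    rw [h1, h2, fourier_neg]
    simp only [smul_eq_mul, RCLike.inner_apply, map_mul, Complex.conj_conj]
    ring
  simp only [e1, e2, e3] at h
  simpa only [mul_comm] using h

theorem fourierCoeff_ofReal_neg (f : Torus → ℝ) (n : ℤ) :
    fourierCoeff (fun x => (f x : ℂ)) (-n) = conj (fourierCoeff (fun x => (f x : ℂ)) n) := by
  simp only [fourierCoeff, ← integral_conj]
  refine integral_congr_ae (Eventually.of_forall fun x => ?_)
  simp

theorem fourierCoeff_const (a : ℂ) (n : ℤ) :
    fourierCoeff (fun _ : Torus => a) n = if n = 0 then a else 0 := by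
  have h := congrFun (fourierCoeff_fourier (T := 2 * π) 0) n
  have h2 := fourierCoeff.const_mul (T := 2 * π) (fun x => fourier 0 x) a n
  simp only [fourier_zero, mul_one] at h2 h
  rw [h2]
  have h3 : (fourierCoeff (fun x : Torus => (1:ℂ)) n) = (Pi.single 0 1 : ℤ → ℂ) n := by
    rw [← h]; congr 1; ext x; simp
  rw [h3, Pi.single_apply]
  split_ifs <;> simp

/-- Square-summability of `n xₙ` gives summability of `xₙ`. -/
theorem summable_norm_of_summable_sq_mul {x : ℤ → ℂ}
    (h : Summable fun n : ℤ => ‖((|n| : ℤ) : ℂ) * x n‖ ^ 2) : Summable fun n => ‖x n‖ := by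
  have h2 : Summable fun n : ℤ => 1 / (n : ℝ) ^ 2 :=
    Real.summable_one_div_int_pow.2 one_lt_two
  have h3 : Summable fun n : ℤ => if n = 0 then ‖x 0‖ else 0 :=
    summable_of_ne_finset_zero (s := {0}) fun n hn => by simp_all
  refine Summable.of_nonneg_of_le (fun n => norm_nonneg _) (fun n => ?_) ((h.add h2).add h3)
  rcases eq_or_ne n 0 with rfl | hn
  · simp
  · have hn' : (0 : ℝ) < |(n : ℝ)| := by positivity
    have e : ‖((|n| : ℤ) : ℂ)‖ = |(n : ℝ)| := by simp
    rw [if_neg hn, add_zero, norm_mul, e, ← sq_abs (n : ℝ)]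
    have := two_mul_le_add_sq (|(n : ℝ)| * ‖x n‖) (1 / |(n : ℝ)|)
    have e2 : 2 * (|(n : ℝ)| * ‖x n‖) * (1 / |(n : ℝ)|) = 2 * ‖x n‖ := by field_simp
    rw [e2, one_div, inv_pow] at this
    rw [one_div]
    linarith [norm_nonneg (x n)]

/-- The analytic factorisation behind the Babenko equation, at the level of Fourier coefficients:
`x` are the coefficients of `φ`, `y` those of `φ²`, `v` those of `φ K φ`. The sequences
`δₙ - (|n| + n) xₙ` and `κ δₙ + (|n| + n) yₙ / 2` are supported on `n ≥ 0`; if `a` and `b` are the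
corresponding boundary functions, the equation says `b = φ ā`, hence `a b = φ |a|²` is real, and a
real function without negative frequencies is constant. -/
theorem sum_antidiagonal_eq_of_convolution {x y v : ℤ → ℂ} {κ : ℝ}
    (hconj : ∀ n, x (-n) = conj (x n))
    (hw : Summable fun n : ℤ => ‖((|n| : ℤ) : ℂ) * x n‖ ^ 2)
    (hy : ∀ n, HasSum (fun k => x k * x (n - k)) (y n))
    (hv : ∀ n, HasSum (fun k => x k * (((|n - k| : ℤ) : ℂ) * x (n - k))) (v n))
    (heq : ∀ n, v n + 1 / 2 * (((|n| : ℤ) : ℂ) * y n) = x n - if n = 0 then (κ : ℂ) else 0)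
    (m : ℕ) :
    ∑ p ∈ Finset.HasAntidiagonal.antidiagonal m,
      ((if p.1 = 0 then 1 else 0) - 2 * (p.1 : ℂ) * x p.1) *
        ((if p.2 = 0 then (κ : ℂ) else 0) + (p.2 : ℂ) * y p.2) = if m = 0 then (κ : ℂ) else 0 := by
  have hx := summable_norm_of_summable_sq_mul hw
  set g : ℤ → ℂ := fun n => (if n = 0 then 1 else 0) - (((|n| : ℤ) : ℂ) + n) * x n with hg
  set h : ℤ → ℂ := fun n =>
    (if n = 0 then (κ : ℂ) else 0) + 1 / 2 * ((((|n| : ℤ) : ℂ) + n) * y n) with hh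
  have hgneg (n : ℤ) (hn : n < 0) : g n = 0 := by
    simp [hg, abs_of_neg hn, hn.ne]
  have hhneg (n : ℤ) (hn : n < 0) : h n = 0 := by
    simp [hh, abs_of_neg hn, hn.ne]
  -- `∑ |k| x_k x_{n-k} = v_n` and, by symmetrisation, `∑ k x_k x_{n-k} = n y_n / 2`
  have hv' (n : ℤ) : HasSum (fun k : ℤ => ((|k| : ℤ) : ℂ) * (x k * x (n - k))) (v n) := by
    refine hasSum_of_eq ((Equiv.subLeft n).hasSum_iff.2 (hv n)) fun k => ?_
    simp only [Function.comp_apply, Equiv.subLeft_apply, sub_sub_cancel]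
    ring
  have hk (n : ℤ) : HasSum (fun k : ℤ => (k : ℂ) * (x k * x (n - k))) ((n : ℂ) / 2 * y n) := by
    have hs : Summable (fun k : ℤ => (k : ℂ) * (x k * x (n - k))) := by
      refine Summable.of_norm ((hv' n).summable.norm.congr fun k => ?_)
      simp
    have h1 := (Equiv.subLeft n).hasSum_iff.2 hs.hasSum
    have h2 := ((hy n).mul_left (n : ℂ)).sub hs.hasSum
    have h3 := h1.unique (hasSum_of_eq h2 fun k => by
      simp only [Function.comp_apply, Equiv.subLeft_apply, sub_sub_cancel]
      push_cast
      ring)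
    have h4 := hs.hasSum
    rwa [show (n : ℂ) / 2 * y n = ∑' k : ℤ, (k : ℂ) * (x k * x (n - k)) by
      linear_combination -(1 / 2 : ℂ) * h3]
  have hconv (n : ℤ) : HasSum (fun k => conj (g k) * x (n + k)) (h n) := by
    have h0 : HasSum (fun k : ℤ => if k = 0 then x n else 0) (x n) := by
      simpa using hasSum_ite_eq (0 : ℤ) (x n)
    have h1 := (Equiv.neg ℤ).hasSum_iff.2 (h0.sub ((hv' n).sub (hk n)))
    rw [show h n = x n - (v n - (n : ℂ) / 2 * y n) by
      simp only [hh]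
      linear_combination heq n]
    refine hasSum_of_eq h1 fun k => ?_
    rcases eq_or_ne k 0 with rfl | hk0
    · simp [hg]
    · simp [hg, hk0, ← hconj, sub_neg_eq_add]
      ring
  have hgsq : Summable fun n => ‖g n‖ ^ 2 := by
    have h3 : Summable fun n : ℤ => if n = 0 then ‖g 0‖ ^ 2 else 0 :=
      summable_of_ne_finset_zero (s := {0}) fun n hn => by simp_all
    refine Summable.of_nonneg_of_le (fun n => by positivity) (fun n => ?_) ((hw.mul_left 4).add h3)
    rcases eq_or_ne n 0 with rfl | hn
    · simp
    · have h1 : ‖((|n| : ℤ) : ℂ) + n‖ ≤ 2 * ‖((|n| : ℤ) : ℂ)‖ := by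
        refine (norm_add_le _ _).trans (le_of_eq ?_)
        simp
        ring
      have h2 : ‖g n‖ ≤ 2 * ‖((|n| : ℤ) : ℂ) * x n‖ := by
        simp only [hg, if_neg hn, zero_sub, norm_neg, norm_mul, ← mul_assoc]
        exact mul_le_mul_of_nonneg_right h1 (norm_nonneg _)
      rw [if_neg hn, add_zero, show (4 : ℝ) = 2 ^ 2 by norm_num, ← mul_pow]
      exact pow_le_pow_left₀ (norm_nonneg _) h2 2
  -- `F m` sums to the `m`-th coefficient of `g h`; as `h` is `ḡ` times the real function with
  -- coefficients `x`, this coefficient is Hermitian in `m`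
  set F : ℤ → ℤ × ℤ → ℂ := fun m p => g p.1 * (conj (g p.2) * x (m - p.1 + p.2)) with hF
  have hFs (m : ℤ) : Summable (F m) := by
    have h1 : Summable fun p : ℤ × ℤ => ‖g p.1‖ ^ 2 * ‖x p.2‖ :=
      hgsq.mul_of_nonneg hx (fun _ => by positivity) fun _ => norm_nonneg _
    have h2 := (Equiv.prodShear (Equiv.refl ℤ) fun j => Equiv.addLeft (m - j)).summable_iff.2 h1
    have h3 := ((Equiv.prodComm ℤ ℤ).trans
      (Equiv.prodShear (Equiv.refl ℤ) fun j => Equiv.subLeft (m + j))).summable_iff.2 h1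
    refine Summable.of_norm_bounded (h2.add h3) fun p => ?_
    simp only [hF, Function.comp_apply, Equiv.prodShear_apply, Equiv.refl_apply,
      Equiv.coe_addLeft, Equiv.trans_apply, Equiv.prodComm_apply, Prod.fst_swap, Prod.snd_swap,
      Equiv.subLeft_apply, norm_mul, RCLike.norm_conj]
    rw [show m + p.2 - p.1 = m - p.1 + p.2 by ring]
    nlinarith [norm_nonneg (x (m - p.1 + p.2)), mul_nonneg (norm_nonneg (x (m - p.1 + p.2)))
      (add_nonneg (sq_nonneg (‖g p.1‖ - ‖g p.2‖)) (add_nonneg (sq_nonneg ‖g p.1‖)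
        (sq_nonneg ‖g p.2‖)))]
  have hS (m : ℤ) : HasSum (fun j => g j * h (m - j)) (∑' p, F m p) :=
    (hFs m).hasSum.prod_fiberwise fun j => (hconv (m - j)).mul_left (g j)
  have hsymm (m : ℤ) : ∑' p, F (-m) p = conj (∑' p, F m p) := by
    rw [← (Equiv.prodComm ℤ ℤ).tsum_eq, Complex.conj_tsum]
    refine tsum_congr fun p => ?_
    simp only [hF, Equiv.prodComm_apply, Prod.fst_swap, Prod.snd_swap, map_mul, Complex.conj_conj,
      ← hconj]
    ring_nf
  have hneg (m : ℤ) (hm : m < 0) : ∑' p, F m p = 0 := by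
    refine (hS m).unique ?_
    convert hasSum_zero with j
    rcases lt_or_ge j 0 with hj | hj
    · rw [hgneg j hj, zero_mul]
    · rw [hhneg _ (by omega), mul_zero]
  have hpos : ∑' p, F m p = ∑ p ∈ Finset.HasAntidiagonal.antidiagonal m, g p.1 * h p.2 := by
    have h1 := (hS m).tsum_eq
    rw [← h1, tsum_eq_sum (s := (Finset.range (m + 1)).map Nat.castEmbedding)]
    · rw [Finset.sum_map, Finset.Nat.sum_antidiagonal_eq_sum_range_succ_mk]
      refine Finset.sum_congr rfl fun k hk => ?_
      have : k ≤ m := by simpa [Nat.lt_succ_iff] using hk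
      simp [Nat.cast_sub this]
    · intro j hj
      rcases lt_or_ge j 0 with hj0 | hj0
      · rw [hgneg j hj0, zero_mul]
      · rw [hhneg, mul_zero]
        lift j to ℕ using hj0
        simp at hj
        omega
  have hfin : ∑' p, F m p = if m = 0 then (κ : ℂ) else 0 := by
    split_ifs with hm
    · rw [hpos, hm]
      simp [hg, hh]
    · have h1 := hsymm m
      rw [hneg _ (by omega)] at h1
      simpa using h1.symm
  rw [← hfin, hpos]
  refine Finset.sum_congr rfl fun p _ => ?_
  simp only [hg, hh, Nat.cast_eq_zero, Nat.abs_cast, Int.cast_natCast]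
  ring

/-! ### The holomorphic extension of a periodic function -/

/-- The kernel `∑_{n ≥ 1} 2 n xⁿ = 2 x / (1 - x)²` at `x = e^{-t - i s}`. -/
noncomputable def dnKernel (t s : ℝ) : ℂ :=
  2 * Complex.exp (-(t + s * Complex.I)) / (1 - Complex.exp (-(t + s * Complex.I))) ^ 2

/-- The holomorphic function in the disc whose boundary values have real part `K u`, that is
`∑_{n ≥ 1} 2 n ûₙ qⁿ`, at the point `q = e^{-t}`, written as an integral over a period. -/
noncomputable def dnExtension (u : ℝ → ℝ) (t : ℝ) : ℂ :=
  (1 / (2 * π) : ℝ) * ∫ s in -π..π, (u s : ℂ) * dnKernel t s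

theorem norm_exp_neg_add_mul_I (t s : ℝ) :
    ‖Complex.exp (-(t + s * Complex.I))‖ = Real.exp (-t) := by
  simp [Complex.norm_exp]

theorem intervalIntegrable_coe_of_integrable {u : Torus → ℝ}
    (hu : Integrable u (haarAddCircle (T := 2 * π))) :
    IntervalIntegrable (fun s : ℝ => u (s : Torus)) volume (-π) π := by
  have h1 : Integrable u (volume : Measure Torus) := by
    rw [AddCircle.volume_eq_smul_haarAddCircle]
    exact hu.smul_measure ENNReal.ofReal_ne_top
  have h2 := ((AddCircle.measurePreserving_mk (2 * π) (-π)).integrable_comp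
    h1.aestronglyMeasurable).2 h1
  rw [intervalIntegrable_iff_integrableOn_Ioc_of_le (by linarith [Real.pi_pos])]
  rw [show -π + 2 * π = π by ring] at h2
  exact h2

theorem hasSum_dnExtension {u : Torus → ℝ}
    (hu : Integrable u (haarAddCircle (T := 2 * π))) {t : ℝ} (ht : 0 < t) :
    HasSum
      (fun n : ℕ => 2 * (n : ℂ) * fourierCoeff (fun x => (u x : ℂ)) n * (Real.exp (-t) : ℂ) ^ n)
      (dnExtension (fun s => u s) t) := by
  have hq : Real.exp (-t) < 1 := by simpa using ht
  have hui := (intervalIntegrable_coe_of_integrable hu)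
  rw [intervalIntegrable_iff_integrableOn_Ioc_of_le (by linarith [Real.pi_pos])] at hui
  set F : ℕ → ℝ → ℂ := fun n s =>
    (u s : ℂ) * (2 * (n * Complex.exp (-(t + s * Complex.I)) ^ n)) with hF
  have hnorm (n : ℕ) (s : ℝ) : ‖F n s‖ = ‖u s‖ * (2 * (n * Real.exp (-t) ^ n)) := by
    simp only [hF, norm_mul, norm_pow, norm_exp_neg_add_mul_I]
    simp
  have hFi (n : ℕ) : Integrable (F n) (volume.restrict (Set.Ioc (-π) π)) := by
    refine Integrable.mono' (hui.norm.mul_const (2 * (n * Real.exp (-t) ^ n))) ?_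
      (Eventually.of_forall fun s => (hnorm n s).le)
    refine AEStronglyMeasurable.mul (Complex.continuous_ofReal.comp_aestronglyMeasurable hui.1) ?_
    exact (by fun_prop : Continuous fun s : ℝ =>
      2 * ((n : ℂ) * Complex.exp (-(t + s * Complex.I)) ^ n)).aestronglyMeasurable
  have hs : Summable fun n => ∫ s in Set.Ioc (-π) π, ‖F n s‖ := by
    simp only [hnorm, integral_mul_const]
    refine Summable.mul_left _ (Summable.mul_left _ ?_)
    exact (hasSum_coe_mul_geometric_of_norm_lt_one
      (by simpa [abs_of_pos (Real.exp_pos _)] using ht)).summable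
  have h := (hasSum_integral_of_summable_integral_norm hFi hs).mul_left ((1 / (2 * π) : ℝ) : ℂ)
  have e : dnExtension (fun s => u s) t =
      ((1 / (2 * π) : ℝ) : ℂ) * ∫ s in Set.Ioc (-π) π, ∑' n, F n s := by
    rw [dnExtension, intervalIntegral.integral_of_le (by linarith [Real.pi_pos])]
    congr 1
    refine integral_congr_ae (Eventually.of_forall fun s => ?_)
    simp only [hF]
    rw [tsum_mul_left, tsum_mul_left, tsum_coe_mul_geometric_of_norm_lt_one
      (by rwa [norm_exp_neg_add_mul_I]), dnKernel]
    ring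
  rw [e]
  refine hasSum_of_eq h fun n => ?_
  rw [fourierCoeff_eq_intervalIntegral _ _ (-π), show -π + 2 * π = π by ring,
    intervalIntegral.integral_of_le (by linarith [Real.pi_pos]), Complex.real_smul,
    mul_left_comm, mul_assoc]
  congr 1
  rw [mul_right_comm, mul_comm, ← integral_mul_const]
  refine integral_congr_ae (Eventually.of_forall fun s => ?_)
  simp only [hF, smul_eq_mul]
  rw [fourier_coe_apply, neg_add, Complex.exp_add, mul_pow, ← Complex.exp_nat_mul _ n,
    ← Complex.exp_nat_mul _ n, Complex.ofReal_exp, ← Complex.exp_nat_mul _ n]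
  have : 2 * (π : ℂ) * Complex.I * ((-(n : ℤ) : ℤ) : ℂ) * s / ((2 * π : ℝ) : ℂ) =
      n * -(s * Complex.I) := by
    have : (π : ℂ) ≠ 0 := by exact_mod_cast Real.pi_ne_zero
    push_cast
    field_simp
  rw [this]
  push_cast
  ring

theorem fourierCoeff_ofReal_affine {f g : Torus → ℝ}
    (hf : MemLp f 2 (haarAddCircle (T := 2 * π))) (hg : MemLp g 2 (haarAddCircle (T := 2 * π)))
    (a b d : ℝ) (n : ℤ) :
    fourierCoeff (fun x => ((a + b * f x + d * g x : ℝ) : ℂ)) n =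
      (if n = 0 then (a : ℂ) else 0) + b * fourierCoeff (fun x => (f x : ℂ)) n +
        d * fourierCoeff (fun x => (g x : ℂ)) n := by
  have i1 : Integrable (fun x => (b : ℂ) * (f x : ℂ)) (haarAddCircle (T := 2 * π)) :=
    (hf.integrable one_le_two).ofReal.const_mul _
  have i2 : Integrable (fun x => (d : ℂ) * (g x : ℂ)) (haarAddCircle (T := 2 * π)) :=
    (hg.integrable one_le_two).ofReal.const_mul _
  have i0 : Integrable (fun _ => (a : ℂ)) (haarAddCircle (T := 2 * π)) := integrable_const _
  have h1 := congrFun (fourierCoeff.add (i0.add i1) i2) n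
  have h2 := congrFun (fourierCoeff.add i0 i1) n
  rw [Pi.add_apply] at h1 h2
  rw [h2, fourierCoeff_const, fourierCoeff.const_mul, fourierCoeff.const_mul] at h1
  rw [← h1]
  congr 1
  ext x
  simp

theorem IsDeepWaterImage.affine {f f' g g' : Torus → ℝ} (hf : IsDeepWaterImage f f')
    (hg : IsDeepWaterImage g g') (a b d : ℝ) :
    IsDeepWaterImage (fun x => a + b * f x + d * g x) (fun x => b * f' x + d * g' x) := by
  refine ⟨((memLp_const a).add (hf.1.const_mul b)).add (hg.1.const_mul d),
    (hf.2.1.const_mul b).add (hg.2.1.const_mul d), fun n => ?_⟩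
  have h := fourierCoeff_ofReal_affine hf.2.1 hg.2.1 0 b d n
  simp only [zero_add, Complex.ofReal_zero, ite_self] at h
  rw [h, fourierCoeff_ofReal_affine hf.1 hg.1, hf.2.2, hg.2.2, deepWaterSymbol_eq]
  split_ifs with hn
  · simp [hn]
  · ring

/-- With `φ = c² / 2 - η`, Babenko's equation reads `φ K φ + K φ² / 2 = φ - c² / 2`. -/
theorem IsBabenkoSolution.exists_crest_form {c : ℝ} {η : Torus → ℝ} (hη : IsBabenkoSolution c η) :
    ∃ v w : Torus → ℝ,
      IsDeepWaterImage (fun x => c ^ 2 / 2 - η x) v ∧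
      IsDeepWaterImage (fun x => (c ^ 2 / 2 - η x) ^ 2) w ∧
      ∀ᵐ x ∂(haarAddCircle (T := 2 * π)),
        (c ^ 2 / 2 - η x) * v x + 1 / 2 * w x = (c ^ 2 / 2 - η x) - c ^ 2 / 2 := by
  obtain ⟨p, q, hp, hq, heq⟩ := hη
  have h1 := hp.affine hq (c ^ 2 / 2) (-1) 0
  have h2 := hp.affine hq (c ^ 4 / 4) (-c ^ 2) 1
  refine ⟨fun x => -1 * p x + 0 * q x, fun x => -c ^ 2 * p x + 1 * q x, ?_, ?_, ?_⟩
  · convert h1 using 2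
    ring
  · convert h2 using 2
    ring
  · filter_upwards [heq] with x hx
    linear_combination -hx

/-- The functions `1 - dnExtension φ` and `c² / 2 + dnExtension φ² / 2` (the derivative of the
conformal map and its reciprocal, up to a factor) have the constant product `c² / 2`. -/
theorem IsBabenkoSolution.mul_dnExtension_eq {c : ℝ} {η : Torus → ℝ} (hη : IsBabenkoSolution c η)
    {t : ℝ} (ht : 0 < t) :
    (1 - dnExtension (fun s => c ^ 2 / 2 - η s) t) *
      ((c ^ 2 / 2 : ℝ) + 1 / 2 * dnExtension (fun s => (c ^ 2 / 2 - η s) ^ 2) t) =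
        (c ^ 2 / 2 : ℝ) := by
  obtain ⟨v, w, ⟨hφ, hv, hvc⟩, ⟨hφsq, hw, hwc⟩, heq⟩ := hη.exists_crest_form
  set φ : Torus → ℝ := fun x => c ^ 2 / 2 - η x with hφdef
  set q : ℂ := (Real.exp (-t) : ℂ) with hq
  have hφC : MemLp (fun x => (φ x : ℂ)) 2 (haarAddCircle (T := 2 * π)) := hφ.ofReal
  have hvC : MemLp (fun x => (v x : ℂ)) 2 (haarAddCircle (T := 2 * π)) := hv.ofReal
  simp only [deepWaterSymbol_eq] at hvc hwc
  have hs := summable_sq_fourierCoeff_of_memLp hvC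
  have hvm := hasSum_fourierCoeff_mul hφC hvC
  simp only [hvc] at hs hvm
  have hsq : (fun x => (φ x : ℂ) * (φ x : ℂ)) = fun x => (((c ^ 2 / 2 - η x) ^ 2 : ℝ) : ℂ) := by
    ext x
    simp only [hφdef]
    push_cast
    ring
  have hφm := hasSum_fourierCoeff_mul hφC hφC
  simp only [hsq] at hφm
  have key := sum_antidiagonal_eq_of_convolution (κ := c ^ 2 / 2) (fourierCoeff_ofReal_neg φ)
    hs hφm hvm (fun n => ?_)
  · have h1 := hasSum_dnExtension (hφ.integrable one_le_two) ht
    have h2 := hasSum_dnExtension (hφsq.integrable one_le_two) ht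
    have g0 : HasSum (fun n : ℕ => if n = 0 then (1 : ℂ) else 0) 1 := by
      simpa using hasSum_ite_eq (0 : ℕ) (1 : ℂ)
    have k0 : HasSum (fun n : ℕ => if n = 0 then ((c ^ 2 / 2 : ℝ) : ℂ) else 0) (c ^ 2 / 2 : ℝ) :=
      hasSum_ite_eq (0 : ℕ) ((c ^ 2 / 2 : ℝ) : ℂ)
    have ha := g0.sub h1
    have hb := k0.add (h2.mul_left (1 / 2))
    have hprod := tsum_mul_tsum_eq_tsum_sum_antidiagonal_of_summable_norm
      ha.summable.norm hb.summable.norm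
    rw [ha.tsum_eq, hb.tsum_eq] at hprod
    refine hprod.trans (Eq.trans (tsum_congr fun n => ?_) k0.tsum_eq)
    have hn : (if n = 0 then ((c ^ 2 / 2 : ℝ) : ℂ) else 0) =
        (if n = 0 then ((c ^ 2 / 2 : ℝ) : ℂ) else 0) * q ^ n := by
      split_ifs with h <;> simp [h]
    rw [hn, ← key n, Finset.sum_mul]
    refine Finset.sum_congr rfl fun p hp => ?_
    rw [← Finset.HasAntidiagonal.mem_antidiagonal.1 hp, pow_add]
    have e1 (m : ℕ) (a : ℂ) : (if m = 0 then a else 0) = (if m = 0 then a else 0) * q ^ m := by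
      split_ifs with h <;> simp [h]
    have ea := e1 p.1 1
    have eb := e1 p.2 ((c ^ 2 / 2 : ℝ) : ℂ)
    rw [← hq]
    generalize fourierCoeff (fun x : Torus => (φ x : ℂ)) p.1 = X
    generalize fourierCoeff (fun x : Torus => (((c ^ 2 / 2 - η x) ^ 2 : ℝ) : ℂ)) p.2 = Y
    generalize (if p.1 = 0 then (1 : ℂ) else 0) = d at *
    generalize (if p.2 = 0 then ((c ^ 2 / 2 : ℝ) : ℂ) else 0) = k at *
    linear_combination (k + p.2 * Y * q ^ p.2) * ea + (d * q ^ p.1 - 2 * p.1 * X * q ^ p.1) * eb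
  · rw [← hwc]
    have h1 := fourierCoeff_ofReal_affine hφ hφ (-(c ^ 2 / 2)) 1 0 n
    have iw : Integrable (fun x => (1 / 2 : ℂ) * (w x : ℂ)) (haarAddCircle (T := 2 * π)) :=
      (hw.integrable one_le_two).ofReal.const_mul _
    have h2 := congrFun (fourierCoeff.add (hφC.integrable_mul hvC) iw) n
    rw [Pi.add_apply, fourierCoeff.const_mul] at h2
    have h3 : fourierCoeff ((fun x => (φ x : ℂ)) * (fun x => (v x : ℂ)) +
        fun x => (1 / 2 : ℂ) * (w x : ℂ)) n =
        fourierCoeff (fun x => ((-(c ^ 2 / 2) + 1 * φ x + 0 * φ x : ℝ) : ℂ)) n := by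
      refine congrFun (fourierCoeff_congr_ae ?_) n
      filter_upwards [heq] with x hx
      simp only [Pi.add_apply, Pi.mul_apply]
      have : φ x * v x + 1 / 2 * w x = -(c ^ 2 / 2) + 1 * φ x + 0 * φ x := by
        linear_combination hx
      rw [← this]
      push_cast
      ring
    rw [h2, h1] at h3
    refine h3.trans ?_
    split_ifs <;> push_cast <;> ring

/-! ### Estimates of the kernel -/

theorem dnKernel_eq_inv (t s : ℝ) : dnKernel t s =
    (((cosh t * cos s - 1 : ℝ) : ℂ) + ((sinh t * sin s : ℝ) : ℂ) * Complex.I)⁻¹ := by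
  have h : Complex.cosh (t + s * Complex.I) =
      ((cosh t * cos s : ℝ) : ℂ) + ((sinh t * sin s : ℝ) : ℂ) * Complex.I := by
    rw [Complex.cosh_add, Complex.cosh_mul_I, Complex.sinh_mul_I]
    push_cast
    ring
  have h2 : ((cosh t * cos s - 1 : ℝ) : ℂ) + ((sinh t * sin s : ℝ) : ℂ) * Complex.I =
      Complex.cosh (t + s * Complex.I) - 1 := by
    rw [h]
    push_cast
    ring
  rw [h2, dnKernel, Complex.cosh, Complex.exp_neg]
  have he := Complex.exp_ne_zero (t + s * Complex.I)
  generalize Complex.exp (t + s * Complex.I) = z at *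
  have e : (z + z⁻¹) / 2 - 1 = (1 - z⁻¹) ^ 2 / (2 * z⁻¹) := by
    field_simp
    ring
  rw [e, inv_div]

theorem sq_add_sq_cosh_cos (t s : ℝ) :
    (cosh t * cos s - 1) ^ 2 + (sinh t * sin s) ^ 2 = (cosh t - cos s) ^ 2 := by
  rw [mul_pow, sinh_sq, sin_sq]
  ring

theorem dnKernel_re (t s : ℝ) :
    (dnKernel t s).re = (cosh t * cos s - 1) / (cosh t - cos s) ^ 2 := by
  rw [dnKernel_eq_inv, Complex.inv_re, Complex.normSq_add_mul_I, sq_add_sq_cosh_cos]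
  simp only [Complex.add_re, Complex.ofReal_re, Complex.re_ofReal_mul, Complex.I_re, mul_zero,
    add_zero]

theorem dnKernel_im (t s : ℝ) :
    (dnKernel t s).im = -(sinh t * sin s) / (cosh t - cos s) ^ 2 := by
  rw [dnKernel_eq_inv, Complex.inv_im, Complex.normSq_add_mul_I, sq_add_sq_cosh_cos]
  simp only [Complex.add_im, Complex.ofReal_im, Complex.im_ofReal_mul, Complex.I_im, mul_one,
    zero_add]

theorem sq_div_five_le_one_sub_cos {s : ℝ} (hs : |s| ≤ π) : s ^ 2 / 5 ≤ 1 - cos s := by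
  have h := Real.cos_le_one_sub_mul_cos_sq hs
  have hpi : π ^ 2 ≤ 10 := by nlinarith [Real.pi_lt_d2, Real.pi_pos]
  have h2 : 1 / 5 ≤ 2 / π ^ 2 := by
    rw [div_le_div_iff₀ (by norm_num) (by positivity)]
    linarith
  nlinarith [sq_nonneg s]

theorem sq_div_two_le_cosh_sub_one (t : ℝ) : t ^ 2 / 2 ≤ cosh t - 1 := by
  have h1 : cosh t - 1 = 2 * sinh (t / 2) ^ 2 := by
    have := cosh_two_mul (t / 2)
    rw [cosh_sq, mul_div_cancel₀ t two_ne_zero] at this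
    linarith
  have h2 : |t / 2| ≤ |sinh (t / 2)| := by
    rw [Real.abs_sinh]
    exact Real.self_le_sinh_iff.2 (abs_nonneg _)
  have h3 := sq_le_sq.2 h2
  rw [h1]
  nlinarith

theorem cosh_sub_one_le_sq {t : ℝ} (ht : |t| ≤ 1) : cosh t - 1 ≤ t ^ 2 := by
  have h1 := Real.cosh_le_exp_half_sq t
  have h0 : t ^ 2 ≤ 1 := by rw [← sq_abs]; nlinarith [abs_nonneg t]
  have h2 := Real.abs_exp_sub_one_sub_id_le (x := t ^ 2 / 2)
    (by rw [abs_of_nonneg (by positivity)]; linarith)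
  have h3 := (abs_le.1 h2).2
  nlinarith [sq_nonneg t]

theorem add_sq_div_five_le_cosh_sub_cos {t s : ℝ} (hs : |s| ≤ π) :
    (t ^ 2 + s ^ 2) / 5 ≤ cosh t - cos s := by
  linarith [sq_div_five_le_one_sub_cos hs, sq_div_two_le_cosh_sub_one t, sq_nonneg t]

theorem cosh_sub_cos_pos {t s : ℝ} (ht : 0 < t) : 0 < cosh t - cos s := by
  linarith [Real.cos_le_one s, Real.one_lt_cosh.2 ht.ne']

theorem abs_dnKernel_re_le {t s : ℝ} (ht : 0 < t) (hs : |s| ≤ π) :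
    |(dnKernel t s).re| ≤ 5 / (t ^ 2 + s ^ 2) := by
  have h0 : 0 < cosh t - cos s := cosh_sub_cos_pos ht
  have h1 := add_sq_div_five_le_cosh_sub_cos (t := t) hs
  have h2 := Real.cos_le_one s
  have h3 := Real.neg_one_le_cos s
  have h4 := Real.one_le_cosh t
  have h5 : |cosh t * cos s - 1| ≤ cosh t - cos s := by
    rw [abs_le]
    constructor <;> nlinarith
  rw [dnKernel_re, abs_div, abs_of_pos (pow_pos h0 2),
    div_le_div_iff₀ (by positivity) (by positivity)]
  calc |cosh t * cos s - 1| * (t ^ 2 + s ^ 2) ≤ (cosh t - cos s) * (5 * (cosh t - cos s)) := by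
        gcongr
        linarith
    _ = _ := by ring

/-- The limit of the real part of the kernel as `t → 0` is `-1 / (1 - cos s)`. -/
theorem abs_dnKernel_re_add_le {t s : ℝ} (ht : 0 < t) (ht1 : t ≤ 1) (hs : |s| ≤ π) (hs0 : s ≠ 0) :
    |(dnKernel t s).re + 1 / (1 - cos s)| ≤ 75 * (t / |s|) ^ 2 / (t ^ 2 + s ^ 2) := by
  have h0 : 0 < cosh t - cos s := cosh_sub_cos_pos ht
  have h1 := add_sq_div_five_le_cosh_sub_cos (t := t) hs
  have h1' := sq_div_five_le_one_sub_cos hs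
  have hs2 : 0 < s ^ 2 := by positivity
  have hc : 0 < 1 - cos s := by linarith
  have h3 := Real.neg_one_le_cos s
  have h4 := Real.one_le_cosh t
  have h5 := cosh_sub_one_le_sq (t := t) (by rwa [abs_of_pos ht])
  have e : (dnKernel t s).re + 1 / (1 - cos s) =
      (cosh t - 1) * ((cosh t - cos s) + (1 - cos s) * (1 + cos s)) /
        ((cosh t - cos s) ^ 2 * (1 - cos s)) := by
    rw [dnKernel_re]
    field_simp
    ring
  have h6 : (cosh t - cos s) + (1 - cos s) * (1 + cos s) ≤ 3 * (cosh t - cos s) := by nlinarith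
  have h7 : 0 ≤ (cosh t - cos s) + (1 - cos s) * (1 + cos s) := by nlinarith
  rw [e, abs_of_nonneg (by
    apply div_nonneg (mul_nonneg (by linarith) h7) (by positivity)), div_pow, sq_abs,
    div_le_iff₀ (by positivity)]
  calc (cosh t - 1) * ((cosh t - cos s) + (1 - cos s) * (1 + cos s))
      ≤ t ^ 2 * (3 * (cosh t - cos s)) := by gcongr
    _ = 75 * (t ^ 2 / s ^ 2) / (t ^ 2 + s ^ 2) *
        ((cosh t - cos s) * ((t ^ 2 + s ^ 2) / 5) * (s ^ 2 / 5)) := by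
        field_simp
        ring
    _ ≤ 75 * (t ^ 2 / s ^ 2) / (t ^ 2 + s ^ 2) * ((cosh t - cos s) ^ 2 * (1 - cos s)) := by
        rw [sq (cosh t - cos s)]
        gcongr

theorem abs_dnKernel_im_le {t s : ℝ} (ht : 0 < t) (ht1 : t ≤ 1) (hs : |s| ≤ π) (hs0 : s ≠ 0) :
    |(dnKernel t s).im| ≤ 50 * (t / |s|) ^ 1 / (t ^ 2 + s ^ 2) := by
  have h0 : 0 < cosh t - cos s := cosh_sub_cos_pos ht
  have h1 := add_sq_div_five_le_cosh_sub_cos (t := t) hs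
  have hs2 : 0 < |s| := by positivity
  have h5 := cosh_sub_one_le_sq (t := t) (by rwa [abs_of_pos ht])
  have hS : |sinh t| ≤ 2 * t := by
    rw [← abs_of_pos (by positivity : 0 < 2 * t)]
    refine sq_le_sq.1 ?_
    rw [sinh_sq]
    have h6 := Real.one_le_cosh t
    have h7 : cosh t + 1 ≤ 3 := by nlinarith
    nlinarith [mul_le_mul h5 h7 (by linarith) (sq_nonneg t)]
  have hsin : |sin s| ≤ |s| := Real.abs_sin_le_abs
  rw [dnKernel_im, abs_div, abs_neg, abs_mul, abs_of_pos (pow_pos h0 2),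
    div_le_iff₀ (by positivity), pow_one]
  calc |sinh t| * |sin s| ≤ 2 * t * |s| := by gcongr
    _ = 50 * (t / |s|) / (t ^ 2 + s ^ 2) * (((t ^ 2 + s ^ 2) / 5) * (|s| ^ 2 / 5)) := by
        field_simp
        ring
    _ ≤ 50 * (t / |s|) / (t ^ 2 + s ^ 2) * (cosh t - cos s) ^ 2 := by
        rw [sq (cosh t - cos s), sq_abs]
        gcongr
        linarith [sq_nonneg t]

theorem integrable_abs_rpow_div_one_add_sq {a : ℝ} (h1 : -1 < a) (h2 : a < 1) :
    Integrable fun s : ℝ => |s| ^ a / (1 + s ^ 2) := by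
  have hm : Measurable fun s : ℝ => |s| ^ a / (1 + s ^ 2) := by fun_prop
  have hpos : IntegrableOn (fun s : ℝ => |s| ^ a / (1 + s ^ 2)) (Set.Ioi 0) := by
    rw [← Set.Ioc_union_Ioi_eq_Ioi zero_le_one]
    refine IntegrableOn.union ?_ ?_
    · have h := (intervalIntegral.intervalIntegrable_rpow' (a := 0) (b := 1) h1)
      rw [intervalIntegrable_iff_integrableOn_Ioc_of_le zero_le_one] at h
      refine Integrable.mono' h hm.aestronglyMeasurable ?_
      refine (ae_restrict_mem measurableSet_Ioc).mono fun s hs => ?_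
      have := hs.1
      rw [Real.norm_of_nonneg (by positivity), abs_of_pos hs.1]
      exact div_le_self (by positivity) (by nlinarith)
    · have h := integrableOn_Ioi_rpow_of_lt (a := a - 2) (by linarith) one_pos
      refine Integrable.mono' h hm.aestronglyMeasurable ?_
      refine (ae_restrict_mem measurableSet_Ioi).mono fun s hs => ?_
      have hs' : (0 : ℝ) < s := one_pos.trans hs
      rw [Real.norm_of_nonneg (by positivity), abs_of_pos hs', Real.rpow_sub hs', Real.rpow_two]
      gcongr
      linarith
  have hneg : IntegrableOn (fun s : ℝ => |s| ^ a / (1 + s ^ 2)) (Set.Iio 0) := by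
    have := (Measure.measurePreserving_neg (volume : Measure ℝ)).integrableOn_comp_preimage
      (Homeomorph.neg ℝ).measurableEmbedding (f := fun s : ℝ => |s| ^ a / (1 + s ^ 2))
      (s := Set.Ioi 0)
    have h3 := this.2 hpos
    convert h3 using 1
    · ext s
      simp
    · ext s
      simp
  have := ((integrableOn_Iic_iff_integrableOn_Iio).2 hneg).union hpos
  rwa [Set.Iic_union_Ioi, integrableOn_univ] at this

theorem integrable_abs_rpow_div_sq_add_sq {a t : ℝ} (h1 : -1 < a) (h2 : a < 1) (ht : 0 < t) :
    Integrable (fun s : ℝ => |s| ^ a / (t ^ 2 + s ^ 2)) ∧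
      ∫ s : ℝ, |s| ^ a / (t ^ 2 + s ^ 2) = t ^ (a - 1) * ∫ s : ℝ, |s| ^ a / (1 + s ^ 2) := by
  have e (s : ℝ) : |s| ^ a / (t ^ 2 + s ^ 2) =
      t ^ (a - 2) * (|s / t| ^ a / (1 + (s / t) ^ 2)) := by
    rw [abs_div, abs_of_pos ht, Real.div_rpow (abs_nonneg s) ht.le, Real.rpow_sub ht, Real.rpow_two]
    have := Real.rpow_pos_of_pos ht a
    field_simp
  simp only [e]
  refine ⟨((integrable_abs_rpow_div_one_add_sq h1 h2).comp_div ht.ne').const_mul _, ?_⟩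
  rw [integral_const_mul, Measure.integral_comp_div (fun s => |s| ^ a / (1 + s ^ 2)), abs_of_pos ht,
    smul_eq_mul, ← mul_assoc]
  congr 1
  rw [show a - 1 = a - 2 + 1 by ring, Real.rpow_add_one ht.ne']

/-! ### Extensions of small remainders -/

theorem ae_ne_zero_real : ∀ᵐ s : ℝ, s ≠ 0 := by
  simp [ae_iff]

theorem exists_abs_le_of_isLittleO {r : ℝ → ℝ} {ν ε : ℝ} (hε : 0 < ε)
    (hro : r =o[𝓝[≠] 0] fun s => |s| ^ ν) :
    ∃ δ > 0, ∀ s, s ≠ 0 → |s| < δ → |r s| ≤ ε * |s| ^ ν := by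
  have h := hro.def hε
  rw [eventually_nhdsWithin_iff, Metric.eventually_nhds_iff] at h
  obtain ⟨δ, hδ, h⟩ := h
  refine ⟨δ, hδ, fun s hs hsδ => ?_⟩
  have := h (by simpa using hsδ) hs
  rwa [Real.norm_eq_abs, Real.norm_eq_abs, abs_of_nonneg (a := |s| ^ ν) (by positivity)] at this

theorem intervalIntegrable_abs_rpow {a : ℝ} (h1 : -1 < a) (h2 : a < 1) :
    IntervalIntegrable (fun s : ℝ => |s| ^ a) volume (-π) π := by
  have h := ((integrable_abs_rpow_div_one_add_sq h1 h2).intervalIntegrable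
    (a := -π) (b := π)).mul_continuousOn (g := fun s => 1 + s ^ 2) (by fun_prop)
  refine h.congr fun s _ => ?_
  have : (1 : ℝ) + s ^ 2 ≠ 0 := by positivity
  field_simp

/-- A remainder `o(|s|^ν)`, integrated against a kernel that is dominated by the homogeneous kernel
`(t / |s|)^j / (t² + s²)` of degree `-2`, contributes `o(t^{ν-1})`; the range of `ν` is the one for
which the homogeneous integral converges. -/
theorem isLittleO_integral_mul_kernel {r : ℝ → ℝ} {κ : ℝ → ℝ → ℝ} {ν M : ℝ} {j : ℕ}
    (hν1 : j - 1 < ν) (hν2 : ν < j + 1) (hr : IntervalIntegrable r volume (-π) π)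
    (hro : r =o[𝓝[≠] 0] fun s => |s| ^ ν) (hM : 0 < M)
    (hκ : ∀ t s : ℝ, 0 < t → t ≤ 1 → |s| ≤ π → s ≠ 0 →
      |κ t s| ≤ M * (t / |s|) ^ j / (t ^ 2 + s ^ 2)) :
    (fun t => ∫ s in -π..π, r s * κ t s) =o[𝓝[>] 0] fun t => t ^ (ν - 1) := by
  have hpi : -π ≤ π := by linarith [Real.pi_pos]
  set J := ∫ s : ℝ, |s| ^ (ν - j) / (1 + s ^ 2) with hJ
  have hJ0 : 0 ≤ J := integral_nonneg fun s => by positivity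
  refine isLittleO_iff.2 fun ε hε => ?_
  set ε' := ε / (2 * M * (J + 1)) with hε'
  have hε'0 : 0 < ε' := by positivity
  obtain ⟨δ, hδ, hδr⟩ := exists_abs_le_of_isLittleO hε'0 hro
  set R := ∫ s in -π..π, |r s| with hR
  have hR0 : 0 ≤ R := intervalIntegral.integral_nonneg hpi fun s _ => abs_nonneg _
  have hfar : Tendsto (fun t : ℝ => M * R * t ^ (j + 1 - ν) / δ ^ (j + 2)) (𝓝[>] 0) (𝓝 0) := by
    have h : Tendsto (fun t : ℝ => t ^ (j + 1 - ν)) (𝓝[>] 0) (𝓝 0) := by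
      have := (Real.continuousAt_rpow_const 0 (j + 1 - ν) (Or.inr (by linarith))).tendsto
      rw [Real.zero_rpow (by linarith)] at this
      exact this.mono_left nhdsWithin_le_nhds
    simpa using (h.const_mul (M * R)).div_const (δ ^ (j + 2))
  filter_upwards [hfar.eventually (ge_mem_nhds (half_pos hε)), self_mem_nhdsWithin,
    Ioc_mem_nhdsGT one_pos] with t hft ht ht1
  have ht : 0 < t := ht
  obtain ⟨hint, hval⟩ := integrable_abs_rpow_div_sq_add_sq (a := ν - j) (t := t)
    (by linarith) (by linarith) ht
  set G : ℝ → ℝ := fun s => M * ε' * t ^ j * (|s| ^ (ν - j) / (t ^ 2 + s ^ 2)) +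
    M * t ^ j / δ ^ (j + 2) * |r s| with hG
  have hGi : IntervalIntegrable G volume (-π) π :=
    (hint.const_mul _).intervalIntegrable.add (hr.abs.const_mul _)
  have hbound : ∀ᵐ s : ℝ, s ∈ Set.Ioc (-π) π → ‖r s * κ t s‖ ≤ G s := by
    filter_upwards [ae_ne_zero_real] with s hs0 hs
    have hsπ : |s| ≤ π := abs_le.2 ⟨hs.1.le, hs.2⟩
    have hs' : 0 < |s| := abs_pos.2 hs0
    have hk := hκ t s ht ht1.2 hsπ hs0
    rw [Real.norm_eq_abs, abs_mul]
    refine (mul_le_mul_of_nonneg_left hk (abs_nonneg _)).trans ?_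
    rcases lt_or_ge |s| δ with h | h
    · calc |r s| * (M * (t / |s|) ^ j / (t ^ 2 + s ^ 2))
          ≤ (ε' * |s| ^ ν) * (M * (t / |s|) ^ j / (t ^ 2 + s ^ 2)) := by
            gcongr
            exact hδr s hs0 h
        _ = M * ε' * t ^ j * (|s| ^ (ν - j) / (t ^ 2 + s ^ 2)) := by
            rw [Real.rpow_sub_natCast hs'.ne', div_pow]
            field_simp
        _ ≤ G s := le_add_of_nonneg_right (by positivity)
    · calc |r s| * (M * (t / |s|) ^ j / (t ^ 2 + s ^ 2))
          = M * t ^ j / (|s| ^ j * (t ^ 2 + s ^ 2)) * |r s| := by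
            rw [div_pow]
            field_simp
        _ ≤ M * t ^ j / δ ^ (j + 2) * |r s| := by
            gcongr
            rw [pow_add]
            gcongr
            rw [← sq_abs s]
            nlinarith
        _ ≤ G s := le_add_of_nonneg_left (by positivity)
  have h1 := intervalIntegral.norm_integral_le_of_norm_le hpi hbound hGi
  have h2 : ∫ s in -π..π, G s ≤ M * ε' * t ^ j * (t ^ (ν - j - 1) * J) +
      M * t ^ j / δ ^ (j + 2) * R := by
    rw [intervalIntegral.integral_add ((hint.const_mul _).intervalIntegrable) (hr.abs.const_mul _),
      intervalIntegral.integral_const_mul, intervalIntegral.integral_const_mul, ← hval,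
      intervalIntegral.integral_of_le hpi]
    gcongr
    · exact Eventually.of_forall fun s => by positivity
    · exact Measure.restrict_le_self
  refine h1.trans (h2.trans ?_)
  have e1 : t ^ (ν - j - 1) = t ^ (ν - 1) / t ^ j := by
    rw [← Real.rpow_sub_natCast ht.ne']
    ring_nf
  have e2 : t ^ j = t ^ (ν - 1) * t ^ (j + 1 - ν) := by
    rw [← Real.rpow_add ht, ← Real.rpow_natCast]
    ring_nf
  have hp : 0 < t ^ (ν - 1) := Real.rpow_pos_of_pos ht _
  rw [Real.norm_of_nonneg hp.le]
  have e3 : M * ε' * t ^ j * (t ^ (ν - j - 1) * J) ≤ ε / 2 * t ^ (ν - 1) := by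
    rw [e1]
    have : M * ε' * t ^ j * (t ^ (ν - 1) / t ^ j * J) = ε / 2 * t ^ (ν - 1) * (J / (J + 1)) := by
      rw [hε']
      field_simp
    rw [this]
    refine mul_le_of_le_one_right (by positivity) ?_
    rw [div_le_one (by positivity)]
    linarith
  have e4 : M * t ^ j / δ ^ (j + 2) * R ≤ ε / 2 * t ^ (ν - 1) := by
    calc M * t ^ j / δ ^ (j + 2) * R
        = (M * R * t ^ (j + 1 - ν) / δ ^ (j + 2)) * t ^ (ν - 1) := by rw [e2]; ring
      _ ≤ _ := by gcongr
  linarith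

theorem continuous_dnKernel {t : ℝ} (ht : 0 < t) : Continuous (dnKernel t) := by
  unfold dnKernel
  refine Continuous.div (by fun_prop) (by fun_prop) fun s h => ?_
  have h1 := norm_exp_neg_add_mul_I t s
  rw [← sub_eq_zero.1 (pow_eq_zero_iff two_ne_zero |>.1 h), norm_one] at h1
  have := Real.exp_lt_exp.2 (neg_lt_zero.2 ht)
  rw [Real.exp_zero] at this
  linarith

theorem intervalIntegrable_mul_dnKernel {u : ℝ → ℝ} (hu : IntervalIntegrable u volume (-π) π)
    {t : ℝ} (ht : 0 < t) :
    IntervalIntegrable (fun s => (u s : ℂ) * dnKernel t s) volume (-π) π :=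
  IntervalIntegrable.mul_continuousOn ⟨hu.1.ofReal, hu.2.ofReal⟩
    (continuous_dnKernel ht).continuousOn

theorem dnExtension_re {u : ℝ → ℝ} (hu : IntervalIntegrable u volume (-π) π) {t : ℝ} (ht : 0 < t) :
    (dnExtension u t).re = 1 / (2 * π) * ∫ s in -π..π, u s * (dnKernel t s).re := by
  have h := Complex.reCLM.intervalIntegral_comp_comm (intervalIntegrable_mul_dnKernel hu ht)
  simp only [Complex.reCLM_apply, Complex.re_ofReal_mul] at h
  rw [dnExtension, Complex.re_ofReal_mul, ← h]

theorem dnExtension_im {u : ℝ → ℝ} (hu : IntervalIntegrable u volume (-π) π) {t : ℝ} (ht : 0 < t) :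
    (dnExtension u t).im = 1 / (2 * π) * ∫ s in -π..π, u s * (dnKernel t s).im := by
  have h := Complex.imCLM.intervalIntegral_comp_comm (intervalIntegrable_mul_dnKernel hu ht)
  simp only [Complex.imCLM_apply, Complex.im_ofReal_mul] at h
  rw [dnExtension, Complex.im_ofReal_mul, ← h]

theorem dnExtension_linear {u v : ℝ → ℝ} (hu : IntervalIntegrable u volume (-π) π)
    (hv : IntervalIntegrable v volume (-π) π) (a b : ℝ) {t : ℝ} (ht : 0 < t) :
    dnExtension (fun s => a * u s + b * v s) t = a * dnExtension u t + b * dnExtension v t := by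
  have h := intervalIntegral.integral_add ((intervalIntegrable_mul_dnKernel hu ht).const_mul a)
    ((intervalIntegrable_mul_dnKernel hv ht).const_mul b)
  simp only [intervalIntegral.integral_const_mul] at h
  have e : (fun s => ((a * u s + b * v s : ℝ) : ℂ) * dnKernel t s) =
      fun s => (a : ℂ) * ((u s : ℂ) * dnKernel t s) + b * ((v s : ℂ) * dnKernel t s) := by
    ext s
    push_cast
    ring
  simp only [dnExtension, e, h]
  ring

theorem dnExtension_re_isLittleO {r : ℝ → ℝ} {ν : ℝ} (hν1 : -1 < ν) (hν2 : ν < 1)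
    (hr : IntervalIntegrable r volume (-π) π) (hro : r =o[𝓝[≠] 0] fun s => |s| ^ ν) :
    (fun t => (dnExtension r t).re) =o[𝓝[>] 0] fun t => t ^ (ν - 1) := by
  have h := isLittleO_integral_mul_kernel (κ := fun t s => (dnKernel t s).re) (j := 0) (M := 5)
    (by simpa using hν1) (by simpa using hν2) hr hro (by norm_num)
    fun t s ht _ hs _ => by simpa using abs_dnKernel_re_le ht hs
  refine (h.const_mul_left (1 / (2 * π))).congr' ?_ EventuallyEq.rfl
  filter_upwards [self_mem_nhdsWithin] with t ht
  exact (dnExtension_re hr ht).symm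

theorem dnExtension_im_isLittleO {r : ℝ → ℝ} {ν : ℝ} (hν1 : 0 < ν) (hν2 : ν < 2)
    (hr : IntervalIntegrable r volume (-π) π) (hro : r =o[𝓝[≠] 0] fun s => |s| ^ ν) :
    (fun t => (dnExtension r t).im) =o[𝓝[>] 0] fun t => t ^ (ν - 1) := by
  have h := isLittleO_integral_mul_kernel (κ := fun t s => (dnKernel t s).im) (j := 1) (M := 50)
    (by simpa using hν1) (by norm_num; linarith) hr hro (by norm_num)
    fun t s ht ht1 hs hs0 => abs_dnKernel_im_le ht ht1 hs hs0
  refine (h.const_mul_left (1 / (2 * π))).congr' ?_ EventuallyEq.rfl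
  filter_upwards [self_mem_nhdsWithin] with t ht
  exact (dnExtension_im hr ht).symm

theorem intervalIntegrable_div_one_sub_cos {r : ℝ → ℝ} {ν : ℝ} (hν1 : 1 < ν) (hν2 : ν < 3)
    (hr : IntervalIntegrable r volume (-π) π) (hro : r =o[𝓝[≠] 0] fun s => |s| ^ ν) :
    IntervalIntegrable (fun s => r s * (1 / (1 - cos s))) volume (-π) π := by
  obtain ⟨δ, hδ, hδr⟩ := exists_abs_le_of_isLittleO one_pos hro
  have hG : IntervalIntegrable (fun s => 5 * |s| ^ (ν - 2) + 5 / δ ^ 2 * |r s|) volume (-π) π :=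
    ((intervalIntegrable_abs_rpow (by linarith) (by linarith)).const_mul _).add
      (hr.abs.const_mul _)
  refine hG.mono_fun ((intervalIntegrable_iff.1 hr).aestronglyMeasurable.mul
    (by fun_prop : Measurable fun s : ℝ => 1 / (1 - cos s)).aestronglyMeasurable) ?_
  filter_upwards [ae_restrict_mem measurableSet_uIoc, ae_restrict_of_ae ae_ne_zero_real]
    with s hs hs0
  rw [Set.uIoc_of_le (by linarith [Real.pi_pos])] at hs
  have hs' : 0 < |s| := abs_pos.2 hs0
  have h1 := sq_div_five_le_one_sub_cos (abs_le.2 ⟨hs.1.le, hs.2⟩)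
  have h2 : 0 < s ^ 2 := by positivity
  have h3 : 1 / (1 - cos s) ≤ 5 / |s| ^ 2 := by
    rw [sq_abs, div_le_div_iff₀ (by linarith) h2]
    linarith
  have h4 : 0 ≤ 1 / (1 - cos s) := by
    have := Real.cos_le_one s
    exact div_nonneg zero_le_one (by linarith)
  rw [Real.norm_eq_abs, abs_mul, abs_of_nonneg h4, Real.norm_of_nonneg (by positivity)]
  refine (mul_le_mul_of_nonneg_left h3 (abs_nonneg _)).trans ?_
  rcases lt_or_ge |s| δ with h | h
  · calc |r s| * (5 / |s| ^ 2) ≤ (1 * |s| ^ ν) * (5 / |s| ^ 2) := by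
          gcongr
          exact hδr s hs0 h
      _ = 5 * |s| ^ (ν - 2) := by
          rw [Real.rpow_sub hs', Real.rpow_two]
          ring
      _ ≤ _ := le_add_of_nonneg_right (by positivity)
  · calc |r s| * (5 / |s| ^ 2) = 5 / |s| ^ 2 * |r s| := mul_comm _ _
      _ ≤ 5 / δ ^ 2 * |r s| := by gcongr
      _ ≤ _ := le_add_of_nonneg_left (by positivity)

/-- For `ν > 1` the kernel has to be regularised by its limit `-1 / (1 - cos s)` as `t → 0`, which
contributes the constant. -/
theorem exists_dnExtension_re_sub_isLittleO {r : ℝ → ℝ} {ν : ℝ} (hν1 : 1 < ν) (hν2 : ν < 3)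
    (hr : IntervalIntegrable r volume (-π) π) (hro : r =o[𝓝[≠] 0] fun s => |s| ^ ν) :
    ∃ α : ℝ, (fun t => (dnExtension r t).re - α) =o[𝓝[>] 0] fun t => t ^ (ν - 1) := by
  have h := isLittleO_integral_mul_kernel (κ := fun t s => (dnKernel t s).re + 1 / (1 - cos s))
    (j := 2) (M := 75) (by norm_num; linarith) (by norm_num; linarith) hr hro (by norm_num)
    fun t s ht ht1 hs hs0 => abs_dnKernel_re_add_le ht ht1 hs hs0
  refine ⟨-(1 / (2 * π) * ∫ s in -π..π, r s * (1 / (1 - cos s))), ?_⟩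
  refine (h.const_mul_left (1 / (2 * π))).congr' ?_ EventuallyEq.rfl
  filter_upwards [self_mem_nhdsWithin] with t ht
  have hre : IntervalIntegrable (fun s => r s * (dnKernel t s).re) volume (-π) π :=
    hr.mul_continuousOn (Complex.continuous_re.comp (continuous_dnKernel ht)).continuousOn
  rw [dnExtension_re hr ht, sub_neg_eq_add, ← mul_add, ← intervalIntegral.integral_add hre
    (intervalIntegrable_div_one_sub_cos hν1 hν2 hr hro)]
  simp only [mul_add]

/-! ### Model functions for the singularity -/

theorem dnExtension_eq_circleAverage (f : ℂ → ℝ) (t : ℝ) :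
    dnExtension (fun s => f (Complex.exp (s * Complex.I))) t =
      circleAverage (fun z => (f z : ℂ) *
        (2 * Real.exp (-t) * z / (z - Real.exp (-t)) ^ 2)) 0 1 := by
  rw [circleAverage_eq_integral_add (-π), intervalIntegral.integral_comp_add_right
    (fun θ => (f (circleMap 0 1 θ) : ℂ) * (2 * Real.exp (-t) * circleMap 0 1 θ /
      (circleMap 0 1 θ - Real.exp (-t)) ^ 2)), zero_add, show 2 * π + -π = π by ring, dnExtension,
    Complex.real_smul, one_div]
  congr 1
  refine intervalIntegral.integral_congr fun s _ => ?_
  simp only [circleMap, Complex.ofReal_one, one_mul, zero_add]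
  congr 1
  rw [dnKernel, neg_add, Complex.exp_add, Complex.exp_neg (s * Complex.I), Complex.ofReal_exp,
    Complex.ofReal_neg]
  have hz := Complex.exp_ne_zero (s * Complex.I)
  generalize Complex.exp (s * Complex.I) = z at *
  generalize Complex.exp (-t) = q
  have e : 1 - q * z⁻¹ = (z - q) / z := by field_simp
  rw [e, div_pow]
  rcases eq_or_ne (z - q) 0 with h | h
  · simp [h]
  · field_simp

/-- Cauchy's formula for the derivative, for the real part of a holomorphic function on the disc:
the integral over the period recovers `q f'(q)`. -/
theorem dnExtension_re_comp_exp {f : ℂ → ℂ} (hf : DiffContOnCl ℂ f (Metric.ball 0 1)) {t : ℝ}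
    (ht : 0 < t) :
    dnExtension (fun s => (f (Complex.exp (s * Complex.I))).re) t =
      Real.exp (-t) * deriv f (Real.exp (-t)) := by
  rw [dnExtension_eq_circleAverage (fun z => (f z).re)]
  have hq0 : 0 < Real.exp (-t) := Real.exp_pos _
  have hq1 : Real.exp (-t) < 1 := by simpa using ht
  generalize Real.exp (-t) = q at *
  have hqb : (q : ℂ) ∈ Metric.ball (0 : ℂ) |1| := by simpa [abs_of_pos hq0] using hq1
  have hcl : closure (Metric.ball (0 : ℂ) 1) = Metric.closedBall 0 1 :=
    closure_ball _ one_ne_zero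
  have hfc : ContinuousOn f (Metric.closedBall 0 1) := hcl ▸ hf.continuousOn
  have hsph : Metric.sphere (0 : ℂ) |1| ⊆ Metric.closedBall 0 1 := by
    rw [abs_one]
    exact Metric.sphere_subset_closedBall
  have hzq {z : ℂ} (hz : z ∈ Metric.sphere (0 : ℂ) |1|) : z - q ≠ 0 := by
    intro h
    rw [sub_eq_zero.1 h] at hz
    simp [abs_of_pos hq0] at hz
    linarith
  have hden {z : ℂ} (hz : z ∈ Metric.closedBall (0 : ℂ) 1) : 1 - q * z ≠ 0 := by
    intro h
    have h1 : ‖(q : ℂ) * z‖ = 1 := by rw [← sub_eq_zero.1 h, norm_one]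
    rw [norm_mul, Complex.norm_real, Real.norm_of_nonneg hq0.le] at h1
    have h2 : ‖z‖ ≤ 1 := by simpa using hz
    nlinarith [norm_nonneg z]
  -- on the circle the kernel is the conjugate of `B`, which is holomorphic on the disc and vanishes
  -- at `0`; so `conj f` does not contribute to the integral
  set B : ℂ → ℂ := fun z => 2 * q * z / (1 - q * z) ^ 2 with hB
  have hBd : DiffContOnCl ℂ B (Metric.ball 0 1) := by
    refine DifferentiableOn.diffContOnCl ?_
    rw [hcl]
    refine DifferentiableOn.div (by fun_prop) (by fun_prop) fun z hz => pow_ne_zero 2 (hden hz)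
  have hBc : ContinuousOn B (Metric.closedBall 0 1) := hcl ▸ hBd.continuousOn
  have hBconj {z : ℂ} (hz : z ∈ Metric.sphere (0 : ℂ) |1|) :
      2 * q * z / (z - q) ^ 2 = conj (B z) := by
    have hz1 : ‖z‖ = 1 := by simpa using hz
    have hz0 : z ≠ 0 := by
      rintro rfl
      simp at hz1
    have hc : conj z = z⁻¹ := by rw [Complex.inv_def, Complex.normSq_eq_norm_sq, hz1]; simp
    simp only [hB, map_div₀, map_mul, map_pow, map_sub, map_one, Complex.conj_ofReal, hc, map_ofNat]
    have e : 1 - q * z⁻¹ = (z - q) / z := by field_simp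
    have := hzq hz
    rw [e, div_pow]
    field_simp
  have mB : circleAverage B 0 1 = 0 := by
    rw [DiffContOnCl.circleAverage (by simpa using hBd)]
    simp [hB]
  have mfB : circleAverage (fun z => f z * B z) 0 1 = 0 := by
    rw [DiffContOnCl.circleAverage (by simpa using hf.smul hBd)]
    simp [hB]
  have iB : CircleIntegrable B 0 1 := (hBc.mono (by simpa using hsph)).circleIntegrable zero_le_one
  have ifB : CircleIntegrable (fun z => f z * B z) 0 1 :=
    ((hfc.mul hBc).mono (by simpa using hsph)).circleIntegrable zero_le_one
  have mconj {g : ℂ → ℂ} (hg : CircleIntegrable g 0 1) (h0 : circleAverage g 0 1 = 0) :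
      circleAverage (fun z => conj (g z)) 0 1 = 0 := by
    have := Complex.conjCLE.toContinuousLinearMap.circleAverage_comp_comm hg
    rw [h0, map_zero] at this
    exact this
  have iconj {g : ℂ → ℂ} (hg : CircleIntegrable g 0 1) :
      CircleIntegrable (fun z => conj (g z)) 0 1 :=
    ⟨Complex.conjCLE.toContinuousLinearMap.integrable_comp hg.1,
      Complex.conjCLE.toContinuousLinearMap.integrable_comp hg.2⟩
  set D : ℂ → ℂ := fun z => z / (z - q) * dslope f q z with hD
  have hnhds : Metric.ball (0 : ℂ) 1 ∈ 𝓝 (q : ℂ) := Metric.isOpen_ball.mem_nhds (by simpa using hqb)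
  have hds : DiffContOnCl ℂ (dslope f q) (Metric.ball 0 1) := by
    refine ⟨(Complex.differentiableOn_dslope hnhds).2 hf.differentiableOn, ?_⟩
    rw [hcl]
    exact (continuousOn_dslope (mem_of_superset hnhds Metric.ball_subset_closedBall)).2
      ⟨hfc, hf.differentiableAt' hnhds⟩
  have mD : circleAverage D 0 1 = deriv f q := by
    have := DiffContOnCl.circleAverage_smul_div (f := dslope f q) (c := 0) (R := 1)
      (by simpa using hds) hqb
    simpa [hD] using this
  have iD : CircleIntegrable D 0 1 := by
    refine ContinuousOn.circleIntegrable zero_le_one ?_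
    rw [← abs_one (α := ℝ)]
    refine ContinuousOn.mul (ContinuousOn.div (by fun_prop) (by fun_prop) fun z hz => hzq hz) ?_
    exact (hcl ▸ hds.continuousOn).mono hsph
  have hcongr : Set.EqOn (fun z => ((f z).re : ℂ) * (2 * q * z / (z - q) ^ 2))
      (fun z => (q : ℂ) • D z + ((f q / 2) • conj (B z) + (1 / 2 : ℂ) • conj (f z * B z)))
      (Metric.sphere 0 |1|) := by
    intro z hz
    have h1 := hzq hz
    have h2 : dslope f q z = (f z - f q) / (z - q) := by
      rw [dslope_of_ne _ (sub_ne_zero.1 h1), slope_def_field]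
    have h3 : ((f z).re : ℂ) = (f z + conj (f z)) / 2 := by
      rw [Complex.add_conj]
      push_cast
      ring
    simp only [hD, smul_eq_mul, map_mul, ← hBconj hz, h2, h3]
    field_simp
    ring
  rw [circleAverage_congr_sphere hcongr, circleAverage_fun_add, circleAverage_fun_add,
    circleAverage_fun_smul, circleAverage_fun_smul, circleAverage_fun_smul, mD, mconj iB mB,
    mconj ifB mfB]
  · simp
  · exact (iconj iB).const_smul
  · exact (iconj ifB).const_smul
  · exact iD.const_smul
  · exact ((iconj iB).const_smul).add (iconj ifB).const_smul

/-- The model function `m(q)^ν` with `m(q) = (1 - q) (3 - q) / 2`. The factor `(3 - q) / 2` removes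
the quadratic term of `1 - e^{-ζ}`, so that `m(e^{-ζ}) = ζ + O(ζ³)`; hence the real part of the
boundary values of `m^ν` is `cos (π ν / 2) |s|^ν` up to a relative error `O(s²)`. -/
noncomputable def crestModel (ν : ℝ) (q : ℂ) : ℂ := ((1 - q) * (3 - q) / 2) ^ (ν : ℂ)

theorem crestModel_base_mem_slitPlane {q : ℂ} (hq : ‖q‖ ≤ 1) (hq1 : q ≠ 1) :
    (1 - q) * (3 - q) / 2 ∈ Complex.slitPlane := by
  rw [Complex.mem_slitPlane_iff]
  have hre : ((1 - q) * (3 - q) / 2).re = ((1 - q.re) * (3 - q.re) - q.im * q.im) / 2 := by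
    simp
  have him : ((1 - q) * (3 - q) / 2).im = q.im * (q.re - 2) := by
    simp
    ring
  have h1 : q.re ≤ 1 := (Complex.re_le_norm q).trans hq
  rw [hre, him]
  rcases eq_or_ne q.im 0 with h | h
  · left
    have h2 : q.re < 1 := by
      refine lt_of_le_of_ne h1 fun h3 => hq1 (Complex.ext ?_ ?_) <;> simp [h3, h]
    rw [h]
    nlinarith
  · right
    exact mul_ne_zero h (by linarith)

theorem diffContOnCl_crestModel {ν : ℝ} (hν : 0 < ν) :
    DiffContOnCl ℂ (crestModel ν) (Metric.ball 0 1) := by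
  refine ⟨fun q hq => ?_, ?_⟩
  · have hq' : ‖q‖ < 1 := by simpa using hq
    refine DifferentiableAt.differentiableWithinAt ?_
    refine DifferentiableAt.cpow (by fun_prop) (by fun_prop)
      (crestModel_base_mem_slitPlane hq'.le ?_)
    rintro rfl
    simp at hq'
  · rw [closure_ball _ one_ne_zero]
    intro q hq
    have hq' : ‖q‖ ≤ 1 := by simpa using hq
    have h : ContinuousAt (fun x : ℂ => x ^ (ν : ℂ)) ((1 - q) * (3 - q) / 2) := by
      refine Complex.continuousAt_cpow_const_of_re_pos ?_ (by simpa using hν)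
      rcases eq_or_ne q 1 with rfl | h1
      · simp
      · exact (Complex.mem_slitPlane_iff.1 (crestModel_base_mem_slitPlane hq' h1)).imp_left le_of_lt
    exact (ContinuousAt.comp (f := fun q : ℂ => (1 - q) * (3 - q) / 2) h
      (by fun_prop)).continuousWithinAt

theorem dnExtension_crestModel {ν : ℝ} (hν : 0 < ν) {t : ℝ} (ht : 0 < t) :
    dnExtension (fun s => (crestModel ν (Complex.exp (s * Complex.I))).re) t =
      ((-(ν * ((1 - Real.exp (-t)) * (3 - Real.exp (-t)) / 2) ^ (ν - 1) *
        (1 - (1 - Real.exp (-t)) ^ 2)) : ℝ) : ℂ) := by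
  rw [dnExtension_re_comp_exp (diffContOnCl_crestModel hν) ht]
  have hq0 : 0 < Real.exp (-t) := Real.exp_pos _
  have hq1 : Real.exp (-t) < 1 := by simpa using ht
  generalize Real.exp (-t) = q at *
  have hm : 0 < (1 - q) * (3 - q) / 2 := by
    have : 0 < (1 - q) * (3 - q) := mul_pos (by linarith) (by linarith)
    linarith
  have hcast : (1 - (q : ℂ)) * (3 - q) / 2 = (((1 - q) * (3 - q) / 2 : ℝ) : ℂ) := by
    push_cast
    ring
  have h1 : HasDerivAt (fun z : ℂ => (1 - z) * (3 - z) / 2) ((q : ℂ) - 2) (q : ℂ) := by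
    have := (((hasDerivAt_id' (q : ℂ)).const_sub 1).mul
      ((hasDerivAt_id' (q : ℂ)).const_sub 3)).div_const 2
    exact this.congr_deriv (by ring)
  have h2 := h1.cpow_const (c := (ν : ℂ)) (by
    rw [hcast]
    exact Complex.ofReal_mem_slitPlane.2 hm)
  have h3 : deriv (crestModel ν) q = _ := h2.deriv
  rw [h3, hcast, ← Complex.ofReal_one, ← Complex.ofReal_sub, ← Complex.ofReal_cpow hm.le]
  push_cast
  ring

/-- At `x = -ζ`: the base of `crestModel` at `e^{-ζ}` is `ζ + O(ζ³)`. -/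
theorem norm_crest_taylor_le {x : ℂ} (hx : ‖x‖ ≤ 1 / 2) :
    ‖(1 - Complex.exp x) * (3 - Complex.exp x) / 2 + x‖ ≤ 2 * ‖x‖ ^ 3 := by
  have h1 := Complex.exp_bound (x := x) (by linarith) (n := 3) (by norm_num)
  have h2 := Complex.exp_bound (x := 2 * x) (by rw [norm_mul]; norm_num; linarith) (n := 3)
    (by norm_num)
  simp only [Finset.sum_range_succ, Finset.sum_range_zero, Nat.factorial, norm_mul] at h1 h2
  norm_num at h1 h2
  have e : (1 - Complex.exp x) * (3 - Complex.exp x) / 2 + x =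
      (Complex.exp (2 * x) - (1 + 2 * x + (2 * x) ^ 2 / 2)) / 2 -
        2 * (Complex.exp x - (1 + x + x ^ 2 / 2)) := by
    rw [two_mul x, Complex.exp_add]
    ring
  rw [e]
  refine (norm_sub_le _ _).trans ?_
  rw [norm_div, norm_mul]
  norm_num
  nlinarith [norm_nonneg x, pow_nonneg (norm_nonneg x) 3]

/-! ### Boundary values and extensions of the model functions -/

/-- The two choices of `ω` are the two sides of the crest. -/
theorem crestModel_re_exp_isBigO_right (ν : ℝ) {ω : ℂ} (hω : ω = Complex.I ∨ ω = -Complex.I) :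
    (fun s : ℝ => (crestModel ν (Complex.exp (s * ω))).re - cos (π * ν / 2) * s ^ ν)
      =O[𝓝[>] 0] fun s => s ^ (ν + 2) := by
  have hωn : ‖ω‖ = 1 := by rcases hω with rfl | rfl <;> simp
  have hω0 : -ω ≠ 0 := by rw [neg_ne_zero, ← norm_ne_zero_iff, hωn]; exact one_ne_zero
  have hslit : -ω ∈ Complex.slitPlane := by
    rw [Complex.mem_slitPlane_iff]
    rcases hω with rfl | rfl <;> simp
  have hre : ((-ω) ^ (ν : ℂ)).re = cos (π * ν / 2) := by
    rw [Complex.cpow_def_of_ne_zero hω0]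
    rcases hω with rfl | rfl
    · rw [Complex.log_neg_I, show -((π : ℂ) / 2) * Complex.I * ν =
        ((-(π * ν / 2) : ℝ) : ℂ) * Complex.I by push_cast; ring, Complex.exp_ofReal_mul_I_re,
        Real.cos_neg]
    · rw [neg_neg, Complex.log_I, show (π : ℂ) / 2 * Complex.I * ν =
        ((π * ν / 2 : ℝ) : ℂ) * Complex.I by push_cast; ring, Complex.exp_ofReal_mul_I_re]
  set m : ℝ → ℂ := fun s => (1 - Complex.exp (s * ω)) * (3 - Complex.exp (s * ω)) / 2 with hm
  have hw : (fun s : ℝ => m s / s - -ω) =O[𝓝[>] 0] fun s => s ^ 2 := by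
    refine IsBigO.of_bound 2 ?_
    filter_upwards [Ioc_mem_nhdsGT (by norm_num : (0 : ℝ) < 1 / 2)] with s hs
    have hs0 : (s : ℂ) ≠ 0 := by exact_mod_cast hs.1.ne'
    have hn : ‖(s : ℂ) * ω‖ = s := by
      rw [norm_mul, hωn, mul_one, Complex.norm_real, Real.norm_of_nonneg hs.1.le]
    have h := norm_crest_taylor_le (x := s * ω) (by rw [hn]; exact hs.2)
    have e : m s / s - -ω = (m s + s * ω) / s := by field_simp; ring
    rw [e, norm_div, Complex.norm_real, Real.norm_of_nonneg hs.1.le,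
      Real.norm_of_nonneg (sq_nonneg s), div_le_iff₀ hs.1]
    rw [hn] at h
    refine h.trans (le_of_eq (by ring))
  have hsq : Tendsto (fun s : ℝ => s ^ 2) (𝓝[>] 0) (𝓝 0) := by
    have : Tendsto (fun s : ℝ => s ^ 2) (𝓝 0) (𝓝 (0 ^ 2)) := (continuous_pow 2).tendsto 0
    rw [zero_pow two_ne_zero] at this
    exact this.mono_left nhdsWithin_le_nhds
  have hwt : Tendsto (fun s : ℝ => m s / s) (𝓝[>] 0) (𝓝 (-ω)) :=
    tendsto_sub_nhds_zero_iff.1 (hw.trans_tendsto hsq)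
  have hd : DifferentiableAt ℂ (fun x : ℂ => x ^ (ν : ℂ)) (-ω) :=
    ((hasDerivAt_id' (-ω)).cpow_const hslit).differentiableAt
  have hpow := (hd.isBigO_sub.comp_tendsto hwt).trans hw
  have hfin : (fun s : ℝ => s ^ ν * ((m s / s) ^ (ν : ℂ) - (-ω) ^ (ν : ℂ)).re)
      =O[𝓝[>] 0] fun s => s ^ ν * s ^ 2 :=
    (isBigO_refl _ _).mul ((IsBigO.of_bound 1 (Eventually.of_forall fun s => by
      rw [one_mul]; exact Complex.abs_re_le_norm _)).trans hpow)
  refine hfin.congr' ?_ ?_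
  · filter_upwards [self_mem_nhdsWithin, hwt.eventually_ne hω0] with s hs hs2
    have hs : 0 < s := hs
    have hs0 : (s : ℂ) ≠ 0 := by exact_mod_cast hs.ne'
    have e : m s = s * (m s / s) := by field_simp
    have e2 : crestModel ν (Complex.exp (s * ω)) = ((s ^ ν : ℝ) : ℂ) * (m s / s) ^ (ν : ℂ) := by
      change m s ^ (ν : ℂ) = _
      rw [Complex.ofReal_cpow hs.le, Complex.cpow_def_of_ne_zero hs0,
        Complex.cpow_def_of_ne_zero hs2, ← Complex.exp_add, ← add_mul, ← Complex.ofReal_log hs.le,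
        ← Complex.log_ofReal_mul hs hs2, ← e, Complex.cpow_def_of_ne_zero]
      rw [e]
      exact mul_ne_zero hs0 hs2
    rw [e2, Complex.re_ofReal_mul, Complex.sub_re, hre]
    ring
  · filter_upwards [self_mem_nhdsWithin] with s hs
    rw [Real.rpow_add hs, Real.rpow_two]

theorem crestModel_re_exp_isBigO (ν : ℝ) :
    (fun s : ℝ => (crestModel ν (Complex.exp (s * Complex.I))).re - cos (π * ν / 2) * |s| ^ ν)
      =O[𝓝[≠] 0] fun s => |s| ^ (ν + 2) := by
  rw [← nhdsLT_sup_nhdsGT, isBigO_sup]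
  constructor
  · have hneg : Tendsto (fun s : ℝ => -s) (𝓝[<] 0) (𝓝[>] 0) := by
      simpa using tendsto_neg_nhdsLT (a := (0 : ℝ))
    refine ((crestModel_re_exp_isBigO_right ν (Or.inr rfl)).comp_tendsto hneg).congr' ?_ ?_
    · filter_upwards [self_mem_nhdsWithin] with s hs
      simp [abs_of_neg (Set.mem_Iio.1 hs)]
    · filter_upwards [self_mem_nhdsWithin] with s hs
      simp [abs_of_neg (Set.mem_Iio.1 hs)]
  · refine (crestModel_re_exp_isBigO_right ν (Or.inl rfl)).congr' ?_ ?_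
    · filter_upwards [self_mem_nhdsWithin] with s hs
      simp [abs_of_pos (Set.mem_Ioi.1 hs)]
    · filter_upwards [self_mem_nhdsWithin] with s hs
      simp [abs_of_pos (Set.mem_Ioi.1 hs)]

theorem intervalIntegrable_crestModel {ν : ℝ} (hν : 0 < ν) (a b : ℝ) :
    IntervalIntegrable (fun s : ℝ => (crestModel ν (Complex.exp (s * Complex.I))).re)
      volume a b := by
  refine Continuous.intervalIntegrable ?_ a b
  have h := (diffContOnCl_crestModel hν).continuousOn
  rw [closure_ball _ one_ne_zero] at h
  refine Complex.continuous_re.comp (h.comp_continuous (by fun_prop) fun s => ?_)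
  simp [Complex.norm_exp]

theorem dnExtension_crestModel_isBigO {ν : ℝ} (hν : 0 < ν) :
    (fun t => dnExtension (fun s => (crestModel ν (Complex.exp (s * Complex.I))).re) t -
      ((-(ν * t ^ (ν - 1)) : ℝ) : ℂ)) =O[𝓝[>] 0] fun t => t ^ (ν + 1) := by
  set m : ℝ → ℝ := fun t => (1 - Real.exp (-t)) * (3 - Real.exp (-t)) / 2 with hm
  have hw : (fun t : ℝ => m t / t - 1) =O[𝓝[>] 0] fun t => t ^ 2 := by
    refine IsBigO.of_bound 2 ?_
    filter_upwards [Ioc_mem_nhdsGT (by norm_num : (0 : ℝ) < 1 / 2)] with t ht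
    have hn : ‖((-t : ℝ) : ℂ)‖ = t := by
      rw [Complex.norm_real, norm_neg, Real.norm_of_nonneg ht.1.le]
    have h := norm_crest_taylor_le (x := ((-t : ℝ) : ℂ)) (by rw [hn]; exact ht.2)
    rw [hn, ← Complex.ofReal_exp] at h
    have e : (1 - (Real.exp (-t) : ℂ)) * (3 - (Real.exp (-t) : ℂ)) / 2 + ((-t : ℝ) : ℂ) =
        ((m t - t : ℝ) : ℂ) := by
      simp only [hm]
      push_cast
      ring
    rw [e, Complex.norm_real] at h
    have ht0 := ht.1.ne'
    have e2 : m t / t - 1 = (m t - t) / t := by field_simp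
    rw [e2, norm_div, Real.norm_of_nonneg ht.1.le, Real.norm_of_nonneg (sq_nonneg t),
      div_le_iff₀ ht.1]
    exact h.trans (le_of_eq (by ring))
  have hsq : Tendsto (fun s : ℝ => s ^ 2) (𝓝[>] 0) (𝓝 0) := by
    have : Tendsto (fun s : ℝ => s ^ 2) (𝓝 0) (𝓝 (0 ^ 2)) := (continuous_pow 2).tendsto 0
    rw [zero_pow two_ne_zero] at this
    exact this.mono_left nhdsWithin_le_nhds
  have hwt : Tendsto (fun t : ℝ => m t / t) (𝓝[>] 0) (𝓝 1) :=
    tendsto_sub_nhds_zero_iff.1 (hw.trans_tendsto hsq)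
  have hd : DifferentiableAt ℝ (fun x : ℝ => x ^ (ν - 1)) 1 :=
    (Real.hasDerivAt_rpow_const (Or.inl one_ne_zero)).differentiableAt
  have hpow := (hd.isBigO_sub.comp_tendsto hwt).trans hw
  have hexp : (fun t : ℝ => (1 - Real.exp (-t)) ^ 2) =O[𝓝[>] 0] fun t => t ^ 2 := by
    refine IsBigO.of_bound 1 ?_
    filter_upwards [self_mem_nhdsWithin] with t ht
    have ht : 0 < t := ht
    have h1 := Real.add_one_le_exp (-t)
    have h2 : Real.exp (-t) < 1 := by simpa using ht
    rw [one_mul, Real.norm_of_nonneg (by positivity), Real.norm_of_nonneg (by positivity)]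
    exact pow_le_pow_left₀ (by linarith) (by linarith) 2
  have hone : (fun t : ℝ => 1 - (1 - Real.exp (-t)) ^ 2) =O[𝓝[>] 0] fun _ => (1 : ℝ) := by
    have : Continuous fun t : ℝ => 1 - (1 - Real.exp (-t)) ^ 2 := by fun_prop
    exact ((this.tendsto 0).mono_left nhdsWithin_le_nhds).isBigO_one ℝ
  have hprod := (isBigO_refl (fun t : ℝ => -(ν * t ^ (ν - 1))) (𝓝[>] 0)).mul
    (((hpow.mul hone).congr_right fun t => mul_one _).sub hexp)
  have hreal : (fun t : ℝ => -(ν * m t ^ (ν - 1) * (1 - (1 - Real.exp (-t)) ^ 2)) -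
      -(ν * t ^ (ν - 1))) =O[𝓝[>] 0] fun t => t ^ (ν + 1) := by
    refine (hprod.congr' ?_ EventuallyEq.rfl).trans (IsBigO.of_bound ν ?_)
    · filter_upwards [self_mem_nhdsWithin, hwt.eventually_const_lt one_pos] with t ht h2
      have ht : 0 < t := ht
      have e : m t = t * (m t / t) := by field_simp
      have e2 : m t ^ (ν - 1) = t ^ (ν - 1) * (m t / t) ^ (ν - 1) := by
        rw [← Real.mul_rpow ht.le h2.le, ← e]
      simp only [Function.comp_apply, Real.one_rpow, e2]
      ring
    · filter_upwards [self_mem_nhdsWithin] with t ht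
      have ht : 0 < t := ht
      rw [show ν + 1 = ν - 1 + 2 by ring, Real.rpow_add ht, Real.rpow_two, norm_mul, norm_mul,
        norm_neg, norm_mul, Real.norm_of_nonneg hν.le, mul_assoc]
  refine (IsBigO.of_bound 1 ?_).trans hreal
  filter_upwards [self_mem_nhdsWithin] with t ht
  rw [dnExtension_crestModel hν ht, ← Complex.ofReal_sub, Complex.norm_real, one_mul]

/-! ### Local expansions of extensions -/

theorem tendsto_rpow_nhdsGT_zero {e : ℝ} (he : 0 < e) :
    Tendsto (fun t : ℝ => t ^ e) (𝓝[>] 0) (𝓝 0) := by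
  have := (Real.continuousAt_rpow_const 0 e (Or.inr he.le)).tendsto
  rw [Real.zero_rpow he.ne'] at this
  exact this.mono_left nhdsWithin_le_nhds

theorem isLittleO_rpow_nhdsGT_zero {a b : ℝ} (h : a < b) :
    (fun t : ℝ => t ^ b) =o[𝓝[>] 0] fun t => t ^ a := by
  have h1 : (fun t : ℝ => t ^ (b - a)) =o[𝓝[>] 0] fun _ => (1 : ℝ) :=
    (isLittleO_one_iff ℝ).2 (tendsto_rpow_nhdsGT_zero (sub_pos.2 h))
  refine (h1.mul_isBigO (isBigO_refl (fun t : ℝ => t ^ a) _)).congr' ?_ ?_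
  · filter_upwards [self_mem_nhdsWithin] with t ht
    rw [← Real.rpow_add ht, sub_add_cancel]
  · filter_upwards with t
    rw [one_mul]

theorem isLittleO_re {f : ℝ → ℂ} {g : ℝ → ℝ} {l : Filter ℝ} (h : f =o[l] g) :
    (fun t => (f t).re) =o[l] g :=
  (IsBigO.of_bound 1 (Eventually.of_forall fun t => by
    simpa using Complex.abs_re_le_norm (f t))).trans_isLittleO h

theorem isLittleO_im {f : ℝ → ℂ} {g : ℝ → ℝ} {l : Filter ℝ} (h : f =o[l] g) :
    (fun t => (f t).im) =o[l] g :=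
  (IsBigO.of_bound 1 (Eventually.of_forall fun t => by
    simpa using Complex.abs_im_le_norm (f t))).trans_isLittleO h

theorem isLittleO_abs_rpow {a b : ℝ} (h : a < b) :
    (fun s : ℝ => |s| ^ b) =o[𝓝[≠] 0] fun s => |s| ^ a :=
  (isLittleO_rpow_nhdsGT_zero h).comp_tendsto tendsto_abs_nhdsNE_zero

/-- Subtraction of a model function removes a term `a |s|^ν` from a local expansion and the
corresponding term `- a ν t^{ν-1} / cos (π ν / 2)` from the extension. -/
theorem exists_sub_model {u : ℝ → ℝ} (hu : IntervalIntegrable u volume (-π) π) (a : ℝ) {ν : ℝ}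
    (hν : 0 < ν) (hcos : cos (π * ν / 2) ≠ 0) :
    ∃ r : ℝ → ℝ, IntervalIntegrable r volume (-π) π ∧
      ((fun s => r s - (u s - a * |s| ^ ν)) =O[𝓝[≠] 0] fun s => |s| ^ (ν + 2)) ∧
      (fun t => dnExtension u t - dnExtension r t -
        ((-(a / cos (π * ν / 2) * (ν * t ^ (ν - 1))) : ℝ) : ℂ)) =O[𝓝[>] 0]
          fun t => t ^ (ν + 1) := by
  set g : ℝ → ℝ := fun s => (crestModel ν (Complex.exp (s * Complex.I))).re with hg
  set b := a / cos (π * ν / 2) with hb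
  have hgi : IntervalIntegrable g volume (-π) π := intervalIntegrable_crestModel hν _ _
  refine ⟨fun s => 1 * u s + (-b) * g s, (hu.const_mul _).add (hgi.const_mul _), ?_, ?_⟩
  · refine ((crestModel_re_exp_isBigO ν).const_mul_left (-b)).congr_left fun s => ?_
    have : b * cos (π * ν / 2) = a := div_mul_cancel₀ a hcos
    rw [← this]
    ring
  · refine ((dnExtension_crestModel_isBigO hν).const_mul_left (b : ℂ)).congr' ?_ EventuallyEq.rfl
    filter_upwards [self_mem_nhdsWithin] with t ht
    rw [dnExtension_linear hu hgi 1 (-b) ht]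
    push_cast
    ring

/-- Both singular terms of a two-term expansion can be removed by model functions. -/
theorem exists_sub_two_models {u : ℝ → ℝ} (hu : IntervalIntegrable u volume (-π) π)
    {a₁ a₂ ν₁ ν₂ : ℝ}
    (hν₁ : 0 < ν₁) (h12 : ν₁ < ν₂) (h21 : ν₂ < ν₁ + 2)
    (hc₁ : cos (π * ν₁ / 2) ≠ 0) (hc₂ : cos (π * ν₂ / 2) ≠ 0)
    (hloc : (fun s => u s - (a₁ * |s| ^ ν₁ + a₂ * |s| ^ ν₂)) =o[𝓝[≠] 0] fun s => |s| ^ ν₂) :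
    ∃ r : ℝ → ℝ, IntervalIntegrable r volume (-π) π ∧ (r =o[𝓝[≠] 0] fun s => |s| ^ ν₂) ∧
      (fun t => dnExtension u t - dnExtension r t -
        ((-(a₁ / cos (π * ν₁ / 2) * (ν₁ * t ^ (ν₁ - 1))) -
          a₂ / cos (π * ν₂ / 2) * (ν₂ * t ^ (ν₂ - 1)) : ℝ) : ℂ)) =o[𝓝[>] 0]
            fun t => t ^ (ν₂ - 1) := by
  obtain ⟨r₁, hr₁, hl₁, he₁⟩ := exists_sub_model hu a₁ hν₁ hc₁
  obtain ⟨r₂, hr₂, hl₂, he₂⟩ := exists_sub_model hr₁ a₂ (hν₁.trans h12) hc₂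
  refine ⟨r₂, hr₂, ?_, ?_⟩
  · have h1 := hl₁.trans_isLittleO (isLittleO_abs_rpow h21)
    have h2 := hl₂.trans_isLittleO (isLittleO_abs_rpow (by linarith : ν₂ < ν₂ + 2))
    refine ((h1.add h2).add hloc).congr_left fun s => ?_
    ring
  · have h1 := he₁.trans_isLittleO (isLittleO_rpow_nhdsGT_zero (by linarith : ν₂ - 1 < ν₁ + 1))
    have h2 := he₂.trans_isLittleO (isLittleO_rpow_nhdsGT_zero (by linarith : ν₂ - 1 < ν₂ + 1))
    refine (h1.add h2).congr_left fun t => ?_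
    push_cast
    ring

/-- The real part of the extension of a function with a two-term expansion. The constant `α` is
only relevant for `ν₂ > 1`, and `ν₂ = 1` is excluded because of a logarithm. -/
theorem dnExtension_re_expansion {u : ℝ → ℝ} (hu : IntervalIntegrable u volume (-π) π)
    {a₁ a₂ ν₁ ν₂ : ℝ}
    (hν₁ : 0 < ν₁) (h12 : ν₁ < ν₂) (h21 : ν₂ < ν₁ + 2) (h3 : ν₂ < 3) (hne : ν₂ ≠ 1)
    (hc₁ : cos (π * ν₁ / 2) ≠ 0) (hc₂ : cos (π * ν₂ / 2) ≠ 0)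
    (hloc : (fun s => u s - (a₁ * |s| ^ ν₁ + a₂ * |s| ^ ν₂)) =o[𝓝[≠] 0] fun s => |s| ^ ν₂) :
    ∃ α : ℝ, (fun t => (dnExtension u t).re - (α - a₁ / cos (π * ν₁ / 2) * (ν₁ * t ^ (ν₁ - 1)) -
        a₂ / cos (π * ν₂ / 2) * (ν₂ * t ^ (ν₂ - 1)))) =o[𝓝[>] 0] fun t => t ^ (ν₂ - 1) := by
  obtain ⟨r, hr, hl, he⟩ := exists_sub_two_models hu hν₁ h12 h21 hc₁ hc₂ hloc
  have hre := isLittleO_re he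
  have hα : ∃ α : ℝ, (fun t => (dnExtension r t).re - α) =o[𝓝[>] 0] fun t => t ^ (ν₂ - 1) := by
    rcases lt_or_gt_of_ne hne with h | h
    · exact ⟨0, by simpa using dnExtension_re_isLittleO (by linarith) h hr hl⟩
    · exact exists_dnExtension_re_sub_isLittleO h h3 hr hl
  obtain ⟨α, hα⟩ := hα
  refine ⟨α, (hre.add hα).congr_left fun t => ?_⟩
  simp only [Complex.sub_re, Complex.ofReal_re]
  ring

/-- The model functions have real extensions on the axis, so the imaginary part of the extension is
of the order of the remainder; `σ` is `ν₂`, lowered below `2` if necessary. -/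
theorem dnExtension_im_expansion {u : ℝ → ℝ} (hu : IntervalIntegrable u volume (-π) π)
    {a₁ a₂ ν₁ ν₂ σ : ℝ}
    (hν₁ : 0 < ν₁) (h12 : ν₁ < ν₂) (h21 : ν₂ < ν₁ + 2) (hσ0 : 0 < σ) (hσ2 : σ < 2) (hσ : σ ≤ ν₂)
    (hc₁ : cos (π * ν₁ / 2) ≠ 0) (hc₂ : cos (π * ν₂ / 2) ≠ 0)
    (hloc : (fun s => u s - (a₁ * |s| ^ ν₁ + a₂ * |s| ^ ν₂)) =o[𝓝[≠] 0] fun s => |s| ^ ν₂) :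
    (fun t => (dnExtension u t).im) =o[𝓝[>] 0] fun t => t ^ (σ - 1) := by
  obtain ⟨r, hr, hl, he⟩ := exists_sub_two_models hu hν₁ h12 h21 hc₁ hc₂ hloc
  have him := isLittleO_im he
  have h1 : (fun s : ℝ => |s| ^ ν₂) =O[𝓝[≠] 0] fun s => |s| ^ σ := by
    rcases hσ.lt_or_eq with h | h
    · exact (isLittleO_abs_rpow h).isBigO
    · rw [h]
  have h2 : (fun s : ℝ => s ^ (ν₂ - 1)) =O[𝓝[>] 0] fun s => s ^ (σ - 1) := by
    rcases hσ.lt_or_eq with h | h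
    · exact (isLittleO_rpow_nhdsGT_zero (by linarith)).isBigO
    · rw [h]
  have hr' := dnExtension_im_isLittleO hσ0 hσ2 hr (hl.trans_isBigO h1)
  refine ((him.trans_isBigO h2).add hr').congr_left fun t => ?_
  simp only [Complex.sub_im, Complex.ofReal_im]
  ring

/-- A corner `B |s|` with `B > 0` makes the extension diverge logarithmically. -/
theorem not_isBigO_one_dnExtension_re_of_pos {r : ℝ → ℝ} (hr : IntervalIntegrable r volume (-π) π)
    {B : ℝ} (hB : 0 < B)
    (hloc : (fun s => r s - B * |s|) =o[𝓝[≠] 0] fun s => |s|) :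
    ¬ (fun t => (dnExtension r t).re) =O[𝓝[>] 0] fun _ => (1 : ℝ) := by
  have hpi : -π ≤ π := by linarith [Real.pi_pos]
  obtain ⟨δ₀, hδ₀, hδr⟩ := exists_abs_le_of_isLittleO (ν := 1) (half_pos hB) (by simpa using hloc)
  simp only [Real.rpow_one] at hδr
  set δ := min (δ₀ / 2) 1 with hδ
  have hδ0 : 0 < δ := lt_min (half_pos hδ₀) one_pos
  have hδ1 : δ < δ₀ := (min_le_left _ _).trans_lt (half_lt_self hδ₀)
  have hδπ : δ ≤ 1 := min_le_right _ _
  set R := ∫ s in -π..π, |r s| with hR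
  set J := ∫ s : ℝ, |s| ^ (0 : ℝ) / (1 + s ^ 2) with hJ
  have hlower : ∀ t ∈ Set.Ioo 0 δ, B / 4 * Real.log (δ / t) - 75 * B * J - 5 / δ ^ 2 * R ≤
      -(2 * π * (dnExtension r t).re) := by
    intro t ⟨ht, htδ⟩
    have ht1 : t ≤ 1 := htδ.le.trans hδπ
    obtain ⟨hint, hval⟩ := integrable_abs_rpow_div_sq_add_sq (a := 0) (t := t)
      (by norm_num) (by norm_num) ht
    have hinv : IntegrableOn (fun s : ℝ => s⁻¹) (Set.Ioc t δ) := by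
      have := (intervalIntegral.intervalIntegrable_inv (f := fun x : ℝ => x) (μ := volume)
        (a := t) (b := δ)
        (fun x hx => by
          rw [Set.uIcc_of_le htδ.le] at hx
          exact (ht.trans_le hx.1).ne') continuousOn_id)
      rwa [intervalIntegrable_iff_integrableOn_Ioc_of_le htδ.le] at this
    -- the logarithm comes from the kernel being of size `1 / s²` on `t < s ≤ δ`
    set I₀ : ℝ → ℝ := (Set.Ioc t δ).indicator fun s => s⁻¹ with hI₀
    have hI₀i : Integrable I₀ := hinv.integrable_indicator measurableSet_Ioc
    have hI₀v : ∫ s in -π..π, I₀ s = Real.log (δ / t) := by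
      rw [intervalIntegral.integral_of_le hpi, hI₀, setIntegral_indicator measurableSet_Ioc,
        Set.inter_eq_right.2, ← intervalIntegral.integral_of_le htδ.le, integral_inv_of_pos ht hδ0]
      intro s hs
      exact ⟨by linarith [hs.1, Real.pi_pos],
        hs.2.trans (hδπ.trans (by linarith [Real.pi_gt_three]))⟩
    have hre : IntervalIntegrable (fun s => r s * (dnKernel t s).re) volume (-π) π :=
      hr.mul_continuousOn (Complex.continuous_re.comp (continuous_dnKernel ht)).continuousOn
    set G : ℝ → ℝ := fun s => B / 4 * I₀ s - 75 * B * t * (|s| ^ (0 : ℝ) / (t ^ 2 + s ^ 2)) -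
      5 / δ ^ 2 * |r s| with hG
    have hG1 := (hI₀i.intervalIntegrable (a := -π) (b := π)).const_mul (B / 4)
    have hG2 := (hint.intervalIntegrable (a := -π) (b := π)).const_mul (75 * B * t)
    have hG3 := hr.abs.const_mul (5 / δ ^ 2)
    have hGi : IntervalIntegrable G volume (-π) π := (hG1.sub hG2).sub hG3
    have hle : ∀ᵐ s ∂(volume.restrict (Set.Icc (-π) π)), G s ≤ -(r s * (dnKernel t s).re) := by
      filter_upwards [ae_restrict_mem measurableSet_Icc, ae_restrict_of_ae ae_ne_zero_real]
        with s hs hs0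
      have hsπ : |s| ≤ π := abs_le.2 hs
      have hs' : 0 < |s| := abs_pos.2 hs0
      have hI₀n : 0 ≤ 75 * B * t * (|s| ^ (0 : ℝ) / (t ^ 2 + s ^ 2)) := by positivity
      have hrn : 0 ≤ 5 / δ ^ 2 * |r s| := by positivity
      rcases le_or_gt |s| δ with h | h
      · have h1 := abs_le.1 (hδr s hs0 (h.trans_lt hδ1))
        have hc0 : 0 < cosh t - cos s := cosh_sub_cos_pos ht
        have hc1 := add_sq_div_five_le_cosh_sub_cos (t := t) hsπ
        have hc2 : cosh t - cos s ≤ t ^ 2 + s ^ 2 := by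
          have := cosh_sub_one_le_sq (t := t) (by rwa [abs_of_pos ht])
          have := Real.one_sub_sq_div_two_le_cos (x := s)
          linarith [sq_nonneg s]
        have hk : -(dnKernel t s).re = 1 / (cosh t - cos s) -
            (cosh t - 1) * (1 + cos s) / (cosh t - cos s) ^ 2 := by
          rw [dnKernel_re]
          field_simp
          ring
        have hk1 : (cosh t - 1) * (1 + cos s) / (cosh t - cos s) ^ 2 ≤
            50 * t ^ 2 / (t ^ 2 + s ^ 2) ^ 2 := by
          rw [div_le_div_iff₀ (by positivity) (by positivity)]
          have h5 := cosh_sub_one_le_sq (t := t) (by rwa [abs_of_pos ht])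
          calc (cosh t - 1) * (1 + cos s) * (t ^ 2 + s ^ 2) ^ 2
              ≤ t ^ 2 * 2 * (5 * (cosh t - cos s)) ^ 2 := by
                gcongr
                · linarith [Real.neg_one_le_cos s]
                · linarith [Real.cos_le_one s]
                · linarith
            _ = _ := by ring
        have hk2 : 0 ≤ (cosh t - 1) * (1 + cos s) / (cosh t - cos s) ^ 2 := by
          have := Real.one_le_cosh t
          have := Real.neg_one_le_cos s
          exact div_nonneg (mul_nonneg (by linarith) (by linarith)) (by positivity)
        have hr1 : B / 2 * |s| ≤ r s := by linarith [h1.1]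
        have hr2 : r s ≤ 3 / 2 * B * |s| := by linarith [h1.2]
        have hr0 : 0 ≤ r s := le_trans (by positivity) hr1
        have p1 : B / 4 * I₀ s ≤ r s * (1 / (cosh t - cos s)) := by
          rw [hI₀]
          by_cases hm : s ∈ Set.Ioc t δ
          · rw [Set.indicator_of_mem hm]
            have hs1 : 0 < s := ht.trans hm.1
            calc B / 4 * s⁻¹ = B / 2 * |s| * (1 / (s ^ 2 + s ^ 2)) := by
                  rw [abs_of_pos hs1]
                  field_simp
                  norm_num
              _ ≤ r s * (1 / (cosh t - cos s)) := by
                  gcongr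
                  refine hc2.trans ?_
                  gcongr
                  exact hm.1.le
          · rw [Set.indicator_of_notMem hm, mul_zero]
            positivity
        have p2 : r s * ((cosh t - 1) * (1 + cos s) / (cosh t - cos s) ^ 2) ≤
            75 * B * t * (|s| ^ (0 : ℝ) / (t ^ 2 + s ^ 2)) := by
          calc r s * ((cosh t - 1) * (1 + cos s) / (cosh t - cos s) ^ 2)
              ≤ (3 / 2 * B * |s|) * (50 * t ^ 2 / (t ^ 2 + s ^ 2) ^ 2) := by gcongr
            _ = 75 * B * t * ((t * |s|) / (t ^ 2 + s ^ 2) ^ 2) := by ring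
            _ ≤ 75 * B * t * (|s| ^ (0 : ℝ) / (t ^ 2 + s ^ 2)) := by
                rw [Real.rpow_zero]
                refine mul_le_mul_of_nonneg_left ?_ (by positivity)
                rw [div_le_div_iff₀ (by positivity) (by positivity), one_mul, sq (t ^ 2 + s ^ 2)]
                refine mul_le_mul_of_nonneg_right ?_ (by positivity)
                rw [← sq_abs s]
                nlinarith [sq_nonneg (t - |s|)]
        have : -(r s * (dnKernel t s).re) = r s * (1 / (cosh t - cos s)) -
            r s * ((cosh t - 1) * (1 + cos s) / (cosh t - cos s) ^ 2) := by
          rw [← mul_sub, ← hk]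
          ring
        rw [this]
        simp only [hG]
        linarith
      · have hm : s ∉ Set.Ioc t δ := fun hm => by
          rw [abs_of_pos (ht.trans hm.1)] at h
          linarith [hm.2]
        have h1 : |r s * (dnKernel t s).re| ≤ 5 / δ ^ 2 * |r s| := by
          rw [abs_mul, mul_comm]
          gcongr
          refine (abs_dnKernel_re_le ht hsπ).trans ?_
          gcongr
          rw [← sq_abs s]
          nlinarith
        have h2 := neg_abs_le (-(r s * (dnKernel t s).re))
        rw [abs_neg] at h2
        simp only [hG, hI₀, Set.indicator_of_notMem hm, mul_zero]
        linarith
    have hmono := intervalIntegral.integral_mono_ae_restrict hpi hGi hre.neg hle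
    have hGv : ∫ s in -π..π, G s = B / 4 * Real.log (δ / t) -
        75 * B * t * (∫ s in -π..π, |s| ^ (0 : ℝ) / (t ^ 2 + s ^ 2)) - 5 / δ ^ 2 * R := by
      rw [intervalIntegral.integral_sub (hG1.sub hG2) hG3, intervalIntegral.integral_sub hG1 hG2,
        intervalIntegral.integral_const_mul, intervalIntegral.integral_const_mul,
        intervalIntegral.integral_const_mul, hI₀v]
    have hJt : t * (∫ s in -π..π, |s| ^ (0 : ℝ) / (t ^ 2 + s ^ 2)) ≤ J := by
      have h1 : (∫ s in -π..π, |s| ^ (0 : ℝ) / (t ^ 2 + s ^ 2)) ≤ t ^ ((0 : ℝ) - 1) * J := by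
        rw [← hval, intervalIntegral.integral_of_le hpi]
        exact setIntegral_le_integral hint (Eventually.of_forall fun s => by positivity)
      rw [zero_sub, Real.rpow_neg_one] at h1
      calc _ ≤ t * (t⁻¹ * J) := by gcongr
        _ = J := by field_simp
    have hd : -(2 * π * (dnExtension r t).re) = ∫ s in -π..π, -(r s * (dnKernel t s).re) := by
      rw [dnExtension_re hr ht, intervalIntegral.integral_neg]
      have := Real.pi_pos.ne'
      field_simp
    rw [hd]
    refine le_trans ?_ hmono
    rw [hGv]
    have := mul_le_mul_of_nonneg_left hJt (by positivity : 0 ≤ 75 * B)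
    linarith
  intro hO
  obtain ⟨M, hM⟩ := hO.bound
  have hlog : Tendsto (fun t : ℝ => B / 4 * Real.log (δ / t) - 75 * B * J - 5 / δ ^ 2 * R)
      (𝓝[>] 0) atTop := by
    have h1 : Tendsto (fun t : ℝ => δ / t) (𝓝[>] 0) atTop := by
      simpa [div_eq_mul_inv] using tendsto_inv_nhdsGT_zero.const_mul_atTop hδ0
    have h2 := (Real.tendsto_log_atTop.comp h1).const_mul_atTop (by positivity : 0 < B / 4)
    exact tendsto_atTop_add_const_right _ _ (tendsto_atTop_add_const_right _ _ h2)
  obtain ⟨t, h1, h2, h3⟩ := ((hlog.eventually_gt_atTop (2 * π * M)).and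
    (hM.and (Ioo_mem_nhdsGT hδ0))).exists
  have h4 := hlower t h3
  rw [norm_one, mul_one, Real.norm_eq_abs] at h2
  have h5 := (abs_le.1 h2).1
  nlinarith [Real.pi_pos]

theorem not_isBigO_one_dnExtension_re {r : ℝ → ℝ} (hr : IntervalIntegrable r volume (-π) π)
    {B : ℝ} (hB : B ≠ 0) (hloc : (fun s => r s - B * |s|) =o[𝓝[≠] 0] fun s => |s|) :
    ¬ (fun t => (dnExtension r t).re) =O[𝓝[>] 0] fun _ => (1 : ℝ) := by
  rcases lt_or_gt_of_ne hB with h | h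
  · intro hO
    have hr' : IntervalIntegrable (fun s => (-1) * r s + 0 * r s) volume (-π) π :=
      (hr.const_mul _).add (hr.const_mul _)
    refine not_isBigO_one_dnExtension_re_of_pos hr' (neg_pos.2 h)
      (hloc.neg_left.congr_left fun s => by ring) (hO.neg_left.congr' ?_ EventuallyEq.rfl)
    filter_upwards [self_mem_nhdsWithin] with t ht
    rw [dnExtension_linear hr hr _ _ ht]
    simp
  · exact not_isBigO_one_dnExtension_re_of_pos hr h hloc

/-! ### Matching of coefficients in a constant product -/

theorem eq_zero_of_const_mul_rpow_isLittleO {a e : ℝ}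
    (h : (fun t : ℝ => a * t ^ e) =o[𝓝[>] 0] fun t => t ^ e) : a = 0 := by
  have h1 := h.tendsto_div_nhds_zero
  have h2 : Tendsto (fun t : ℝ => a * t ^ e / t ^ e) (𝓝[>] 0) (𝓝 a) := by
    refine tendsto_const_nhds.congr' ?_
    filter_upwards [self_mem_nhdsWithin] with t ht
    rw [mul_div_cancel_right₀ _ (Real.rpow_pos_of_pos ht e).ne']
  exact tendsto_nhds_unique h2 h1

theorem tendsto_of_expansion {p : ℝ → ℝ} {C D e : ℝ} (he : 0 < e)
    (hp : (fun t => p t - (C + D * t ^ e)) =o[𝓝[>] 0] fun t => t ^ e) :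
    Tendsto p (𝓝[>] 0) (𝓝 C) := by
  have h1 := hp.isBigO.trans_tendsto (tendsto_rpow_nhdsGT_zero he)
  have h2 := ((tendsto_rpow_nhdsGT_zero he).const_mul D).const_add C
  have h3 := h1.add h2
  simp only [sub_add_cancel] at h3
  simpa using h3

/-- If the product of two two-term expansions is constant up to the order of their second terms,
the cross terms cancel. -/
theorem expansion_mul_eq_const {p r : ℝ → ℝ} {C₁ C₂ D₁ D₂ K e : ℝ} (he : 0 < e)
    (hp : (fun t => p t - (C₁ + D₁ * t ^ e)) =o[𝓝[>] 0] fun t => t ^ e)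
    (hr : (fun t => r t - (C₂ + D₂ * t ^ e)) =o[𝓝[>] 0] fun t => t ^ e)
    (hpr : (fun t => p t * r t - K) =o[𝓝[>] 0] fun t => t ^ e) :
    C₁ * C₂ = K ∧ C₁ * D₂ + D₁ * C₂ = 0 := by
  have hpt := tendsto_of_expansion he hp
  have hrt := tendsto_of_expansion he hr
  have hK : C₁ * C₂ = K := by
    have h1 := hpr.isBigO.trans_tendsto (tendsto_rpow_nhdsGT_zero he)
    exact tendsto_nhds_unique (hpt.mul hrt) (tendsto_sub_nhds_zero_iff.1 h1)
  refine ⟨hK, eq_zero_of_const_mul_rpow_isLittleO (e := e) ?_⟩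
  have h1 := hp.mul_isBigO (hrt.isBigO_one ℝ)
  have h2 : (fun t : ℝ => (C₁ + D₁ * t ^ e) * (r t - (C₂ + D₂ * t ^ e))) =o[𝓝[>] 0]
      fun t => 1 * t ^ e :=
    ((((tendsto_rpow_nhdsGT_zero he).const_mul D₁).const_add C₁).isBigO_one ℝ).mul_isLittleO hr
  have h3 : (fun t : ℝ => D₁ * D₂ * (t ^ e * t ^ e)) =o[𝓝[>] 0] fun t => 1 * t ^ e :=
    ((((isLittleO_one_iff ℝ).2 (tendsto_rpow_nhdsGT_zero he)).mul_isBigO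
      (isBigO_refl (fun t : ℝ => t ^ e) _))).const_mul_left _
  simp only [mul_one, one_mul] at h1 h2 h3
  refine (hpr.sub ((h1.add h2).add h3)).congr_left fun t => ?_
  rw [← hK]
  ring

section Matching

variable {Er Ei Fr Fi : ℝ → ℝ} {K β C₁ C₂ D₂ e : ℝ}

/-- With the factors rescaled to have finite nonzero limits, the product is constant up to the
product of the imaginary parts. -/
theorem rescaled_product_isLittleO
    (hprod : ∀ t > 0, (1 - Er t) * (K + Fr t / 2) + Ei t * Fi t / 2 = K)
    (hIm : (fun t => Ei t * Fi t) =o[𝓝[>] 0] fun t => t ^ e) :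
    (fun t => t ^ (1 / 3 : ℝ) * (1 - Er t) * (t ^ (-(1 / 3) : ℝ) * (K + Fr t / 2)) - K)
      =o[𝓝[>] 0] fun t => t ^ e := by
  refine (hIm.const_mul_left (-(1 / 2))).congr' ?_ EventuallyEq.rfl
  filter_upwards [self_mem_nhdsWithin] with t ht
  have ht : 0 < t := ht
  have h1 : t ^ (1 / 3 : ℝ) * t ^ (-(1 / 3) : ℝ) = 1 := by
    rw [← Real.rpow_add ht]
    simp
  linear_combination (-(1 - Er t) * (K + Fr t / 2)) * h1 - hprod t ht

/-- The factor `K + F / 2` has no constant term, as the other factor blows up and the product is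
bounded. -/
theorem rescaled_second_factor (he : 0 < e) (hC₁ : C₁ ≠ 0)
    (hprod : ∀ t > 0, (1 - Er t) * (K + Fr t / 2) + Ei t * Fi t / 2 = K)
    (hIm : (fun t => Ei t * Fi t) =o[𝓝[>] 0] fun t => t ^ e)
    (hp : Tendsto (fun t => t ^ (1 / 3 : ℝ) * (1 - Er t)) (𝓝[>] 0) (𝓝 C₁))
    (hF : (fun t => Fr t - (β - C₂ * t ^ (1 / 3 : ℝ) - D₂ * t ^ (e + 1 / 3))) =o[𝓝[>] 0]
      fun t => t ^ (e + 1 / 3)) :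
    (fun t => t ^ (-(1 / 3) : ℝ) * (K + Fr t / 2) - (-(C₂ / 2) + -(D₂ / 2) * t ^ e)) =o[𝓝[>] 0]
      fun t => t ^ e := by
  have he' : 0 < e + 1 / 3 := by linarith
  have h13 : Tendsto (fun t : ℝ => t ^ (1 / 3 : ℝ)) (𝓝[>] 0) (𝓝 0) :=
    tendsto_rpow_nhdsGT_zero (by norm_num)
  have hlim : Tendsto (fun t => K + Fr t / 2) (𝓝[>] 0) (𝓝 (K + β / 2)) := by
    have h1 := hF.isBigO.trans_tendsto (tendsto_rpow_nhdsGT_zero he')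
    have h2 := ((h13.const_mul C₂).const_sub β).sub
      ((tendsto_rpow_nhdsGT_zero he').const_mul D₂)
    have h3 := (((h1.add h2).div_const 2).const_add K)
    simpa using h3
  have hβ : K + β / 2 = 0 := by
    have h1 := hp.mul hlim
    have h2 : Tendsto (fun t => t ^ (1 / 3 : ℝ) * (K - 1 / 2 * (Ei t * Fi t))) (𝓝[>] 0)
        (𝓝 (0 * (K - 1 / 2 * 0))) :=
      h13.mul (((hIm.isBigO.trans_tendsto (tendsto_rpow_nhdsGT_zero he)).const_mul _).const_sub K)
    rw [zero_mul] at h2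
    have h3 := tendsto_nhds_unique (h1.congr' ?_) h2
    · exact (mul_eq_zero.1 h3).resolve_left hC₁
    · filter_upwards [self_mem_nhdsWithin] with t ht
      linear_combination t ^ (1 / 3 : ℝ) * hprod t ht
  have h1 := ((isBigO_refl (fun t : ℝ => t ^ (-(1 / 3) : ℝ)) (𝓝[>] 0)).mul_isLittleO
    hF).const_mul_left (1 / 2)
  refine h1.congr' ?_ ?_
  · filter_upwards [self_mem_nhdsWithin] with t ht
    have ht : 0 < t := ht
    have h3 : t ^ (-(1 / 3) : ℝ) * t ^ (1 / 3 : ℝ) = 1 := by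
      rw [← Real.rpow_add ht]
      simp
    rw [Real.rpow_add ht]
    linear_combination (C₂ / 2 + D₂ / 2 * t ^ e) * h3 - t ^ (-(1 / 3) : ℝ) * hβ
  · filter_upwards [self_mem_nhdsWithin] with t ht
    have ht : 0 < t := ht
    rw [← Real.rpow_add ht]
    ring_nf

/-- Matching the coefficients in the constant product. For `μ > 1` the constant `1 - α` of the first
factor is of lower order than the `D₁` term and has to vanish first. -/
theorem coefficient_relation {α D₁ μ : ℝ} (hμ : 2 / 3 < μ) (hμ1 : μ ≠ 1)
    (hC₁ : C₁ ≠ 0) (hC₂ : C₂ ≠ 0)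
    (hprod : ∀ t > 0, (1 - Er t) * (K + Fr t / 2) + Ei t * Fi t / 2 = K)
    (hEi : Ei =o[𝓝[>] 0] fun t => t ^ (μ - 1))
    (hFi : Fi =o[𝓝[>] 0] fun t => t ^ (1 / 3 : ℝ))
    (hE : (fun t => Er t - (α - C₁ * t ^ (-(1 / 3) : ℝ) - D₁ * t ^ (μ - 1))) =o[𝓝[>] 0]
      fun t => t ^ (μ - 1))
    (hF : (fun t => Fr t - (β - C₂ * t ^ (1 / 3 : ℝ) - D₂ * t ^ (μ - 2 / 3 + 1 / 3))) =o[𝓝[>] 0]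
      fun t => t ^ (μ - 2 / 3 + 1 / 3)) :
    C₁ * D₂ + D₁ * C₂ = 0 := by
  set e := μ - 2 / 3 with he
  have he0 : 0 < e := by linarith
  have h13 : Tendsto (fun t : ℝ => t ^ (1 / 3 : ℝ)) (𝓝[>] 0) (𝓝 0) :=
    tendsto_rpow_nhdsGT_zero (by norm_num)
  have hIm : (fun t => Ei t * Fi t) =o[𝓝[>] 0] fun t => t ^ e := by
    refine (hEi.mul hFi).congr' EventuallyEq.rfl ?_
    filter_upwards [self_mem_nhdsWithin] with t ht
    rw [← Real.rpow_add ht, he]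
    ring_nf
  have hp0 : (fun t => t ^ (1 / 3 : ℝ) * (1 - Er t) -
      (C₁ + (1 - α) * t ^ (1 / 3 : ℝ) + D₁ * t ^ e)) =o[𝓝[>] 0] fun t => t ^ e := by
    have h1 := ((isBigO_refl (fun t : ℝ => t ^ (1 / 3 : ℝ)) (𝓝[>] 0)).mul_isLittleO
      hE).const_mul_left (-1)
    refine h1.congr' ?_ ?_
    · filter_upwards [self_mem_nhdsWithin] with t ht
      have ht : 0 < t := ht
      have h3 : t ^ (1 / 3 : ℝ) * t ^ (-(1 / 3) : ℝ) = 1 := by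
        rw [← Real.rpow_add ht]
        simp
      have h4 : t ^ (1 / 3 : ℝ) * t ^ (μ - 1) = t ^ e := by
        rw [← Real.rpow_add ht, he]
        ring_nf
      linear_combination -C₁ * h3 - D₁ * h4
    · filter_upwards [self_mem_nhdsWithin] with t ht
      rw [← Real.rpow_add ht, he]
      ring_nf
  have hpt : Tendsto (fun t => t ^ (1 / 3 : ℝ) * (1 - Er t)) (𝓝[>] 0) (𝓝 C₁) := by
    have h1 := hp0.isBigO.trans_tendsto (tendsto_rpow_nhdsGT_zero he0)
    have h2 := ((h13.const_mul (1 - α)).const_add C₁).add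
      ((tendsto_rpow_nhdsGT_zero he0).const_mul D₁)
    have h3 := h1.add h2
    simp only [sub_add_cancel] at h3
    simpa using h3
  have hr := rescaled_second_factor he0 hC₁ hprod hIm hpt hF
  have hpr := rescaled_product_isLittleO hprod hIm
  have hp : (fun t => t ^ (1 / 3 : ℝ) * (1 - Er t) - (C₁ + D₁ * t ^ e)) =o[𝓝[>] 0]
      fun t => t ^ e := by
    rcases lt_or_gt_of_ne hμ1 with h | h
    · have h1 : (fun t : ℝ => (1 - α) * t ^ (1 / 3 : ℝ)) =o[𝓝[>] 0] fun t => t ^ e :=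
        (isLittleO_rpow_nhdsGT_zero (by linarith)).const_mul_left _
      refine (hp0.add h1).congr_left fun t => ?_
      ring
    · have hlt : (1 / 3 : ℝ) < e := by linarith
      have ho := isLittleO_rpow_nhdsGT_zero hlt
      have h1 : (fun t => t ^ (1 / 3 : ℝ) * (1 - Er t) - (C₁ + (1 - α) * t ^ (1 / 3 : ℝ)))
          =o[𝓝[>] 0] fun t => t ^ (1 / 3 : ℝ) := by
        refine ((hp0.trans ho).add (ho.const_mul_left D₁)).congr_left fun t => ?_
        ring
      have h2 : (fun t => t ^ (-(1 / 3) : ℝ) * (K + Fr t / 2) -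
          (-(C₂ / 2) + 0 * t ^ (1 / 3 : ℝ))) =o[𝓝[>] 0] fun t => t ^ (1 / 3 : ℝ) := by
        refine ((hr.trans ho).add (ho.const_mul_left (-(D₂ / 2)))).congr_left fun t => ?_
        ring
      have h3 := (expansion_mul_eq_const (by norm_num) h1 h2 (hpr.trans ho)).2
      have h4 : 1 - α = 0 := by
        have : (1 - α) * C₂ = 0 := by linear_combination -2 * h3
        exact (mul_eq_zero.1 this).resolve_right hC₂
      simpa only [h4, zero_mul, add_zero] using hp0
  have := (expansion_mul_eq_const he0 hp hr hpr).2
  linear_combination -2 * this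

/-- The borderline exponent: an expansion of the second factor to order `t^{2/3}` bounds the first
factor minus its leading term. -/
theorem first_factor_isBigO_one (hC₁ : C₁ ≠ 0) (hC₂ : C₂ ≠ 0)
    (hprod : ∀ t > 0, (1 - Er t) * (K + Fr t / 2) + Ei t * Fi t / 2 = K)
    (hIm : (fun t => Ei t * Fi t) =o[𝓝[>] 0] fun t => t ^ (1 / 3 : ℝ))
    (hpt : Tendsto (fun t => t ^ (1 / 3 : ℝ) * (1 - Er t)) (𝓝[>] 0) (𝓝 C₁))
    (hF : (fun t => Fr t - (β - C₂ * t ^ (1 / 3 : ℝ) - D₂ * t ^ (1 / 3 + 1 / 3 : ℝ))) =o[𝓝[>] 0]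
      fun t => t ^ (1 / 3 + 1 / 3 : ℝ)) :
    (fun t => 1 - Er t - C₁ * t ^ (-(1 / 3) : ℝ)) =O[𝓝[>] 0] fun _ => (1 : ℝ) := by
  have he0 : (0 : ℝ) < 1 / 3 := by norm_num
  have hr := rescaled_second_factor he0 hC₁ hprod hIm hpt hF
  have hpr := rescaled_product_isLittleO hprod hIm
  have hrt := tendsto_of_expansion he0 hr
  have hne : -(C₂ / 2) ≠ 0 := neg_ne_zero.2 (div_ne_zero hC₂ two_ne_zero)
  have hK : C₁ * -(C₂ / 2) = K :=
    tendsto_nhds_unique (hpt.mul hrt)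
      (tendsto_sub_nhds_zero_iff.1 (hpr.isBigO.trans_tendsto (tendsto_rpow_nhdsGT_zero he0)))
  have h1 : (fun t => t ^ (-(1 / 3) : ℝ) * (K + Fr t / 2) - -(C₂ / 2)) =O[𝓝[>] 0]
      fun t => t ^ (1 / 3 : ℝ) := by
    refine (hr.isBigO.add ((isBigO_refl (fun t : ℝ => t ^ (1 / 3 : ℝ)) _).const_mul_left
      (-(D₂ / 2)))).congr_left fun t => ?_
    ring
  have h2 := ((hpr.isBigO.sub (h1.const_mul_left C₁)).mul
    ((hrt.inv₀ hne).isBigO_one ℝ)).mul (isBigO_refl (fun t : ℝ => t ^ (-(1 / 3) : ℝ)) (𝓝[>] 0))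
  refine h2.congr' ?_ ?_
  · filter_upwards [self_mem_nhdsWithin, hrt.eventually_ne hne] with t ht hr0
    have ht : 0 < t := ht
    have h3 : t ^ (1 / 3 : ℝ) * t ^ (-(1 / 3) : ℝ) = 1 := by
      rw [← Real.rpow_add ht]
      simp
    rw [← hK]
    rw [← hK] at hr0
    generalize t ^ (-(1 / 3) : ℝ) * (C₁ * -(C₂ / 2) + Fr t / 2) = r at *
    field_simp
    linear_combination (2 * r * (1 - Er t)) * h3
  · filter_upwards [self_mem_nhdsWithin] with t ht
    rw [mul_one, ← Real.rpow_add ht]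
    simp

end Matching

/-! ### Grant's equation -/

/-- Grant's equation multiplied by its two cosines; the first factor vanishes at `2 / 3`
only, the second one carries all the other roots in `(0, 2)`. -/
theorem grant_mul_cos_cos {μ : ℝ} (h1 : cos (π * μ / 2 + π / 3) ≠ 0) (h2 : cos (π * μ / 2) ≠ 0) :
    ((μ + 2 / 3) * tan (π * μ / 2 + π / 3) + μ * tan (π * μ / 2) + 2 / √3) *
        (cos (π * μ / 2 + π / 3) * cos (π * μ / 2)) =
      2 / 3 * cos (π * μ / 2 + π / 6) *
        (3 * μ * cos (π * μ / 2 - π / 3) + 2 * cos (π * μ / 2)) := by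
  have h3 : √3 ≠ 0 := by positivity
  have h33 : √3 ^ 2 = 3 := Real.sq_sqrt (by norm_num)
  rw [tan_eq_sin_div_cos, tan_eq_sin_div_cos]
  have e : ∀ a b c d k : ℝ, b ≠ 0 → d ≠ 0 →
      ((μ + 2 / 3) * (a / b) + μ * (c / d) + k) * (b * d) =
        (μ + 2 / 3) * a * d + μ * c * b + k * (b * d) := by
    intro a b c d k hb hd
    field_simp
  rw [e _ _ _ _ _ h1 h2, sin_add, cos_add, cos_add, cos_sub, cos_pi_div_three, sin_pi_div_three,
    cos_pi_div_six, sin_pi_div_six]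
  have h4 : 2 / √3 = 2 / 3 * √3 := by
    field_simp
    linarith
  rw [h4]
  generalize sin (π * μ / 2) = S at *
  generalize cos (π * μ / 2) = C at *
  generalize √3 = q at *
  linear_combination (-(1 / 2) * μ * S * C - 1 / 3 * S * C) * h33

/-- The second factor of Grant's equation. -/
noncomputable def grantFactor (μ : ℝ) : ℝ :=
  3 * μ * cos (π * μ / 2 - π / 3) + 2 * cos (π * μ / 2)

theorem grantFactor_pos_of_le_one {μ : ℝ} (h0 : 0 < μ) (h1 : μ ≤ 1) : 0 < grantFactor μ := by
  have hp := Real.pi_pos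
  have hx0 : 0 < π * μ / 2 := by positivity
  have hx1 : π * μ / 2 ≤ π / 2 := by nlinarith
  have hc1 : 0 < cos (π * μ / 2 - π / 3) := cos_pos_of_mem_Ioo ⟨by linarith, by linarith⟩
  have hc2 : 0 ≤ cos (π * μ / 2) := cos_nonneg_of_mem_Icc ⟨by linarith, hx1⟩
  have := mul_pos (mul_pos three_pos h0) hc1
  unfold grantFactor
  linarith

theorem grantFactor_neg_of_ge {μ : ℝ} (h0 : 5 / 3 ≤ μ) (h1 : μ < 2) : grantFactor μ < 0 := by
  have hp := Real.pi_pos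
  have hx0 : 5 * π / 6 ≤ π * μ / 2 := by nlinarith
  have hx1 : π * μ / 2 < π := by nlinarith
  have hc1 : cos (π * μ / 2 - π / 3) ≤ 0 :=
    cos_nonpos_of_pi_div_two_le_of_le (by linarith) (by linarith)
  have hc2 : cos (π * μ / 2) < 0 := cos_neg_of_pi_div_two_lt_of_lt (by linarith) (by linarith)
  have := mul_nonpos_of_nonneg_of_nonpos (by linarith : 0 ≤ 3 * μ) hc1
  unfold grantFactor
  linarith

theorem grantFactor_strictAntiOn : StrictAntiOn grantFactor (Set.Icc 1 (5 / 3)) := by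
  have hd (μ : ℝ) : HasDerivAt grantFactor
      (3 * cos (π * μ / 2 - π / 3) - π / 2 * (3 * μ * sin (π * μ / 2 - π / 3) +
        2 * sin (π * μ / 2))) μ := by
    have h1 : HasDerivAt (fun μ : ℝ => π * μ / 2) (π / 2) μ := by
      simpa using ((hasDerivAt_id μ).const_mul π).div_const 2
    have h2 := (((hasDerivAt_id μ).const_mul 3).mul (h1.sub_const (π / 3)).cos).add
      (h1.cos.const_mul 2)
    refine h2.congr_deriv ?_
    simp only [id]
    ring
  refine strictAntiOn_of_deriv_neg (convex_Icc _ _)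
    (fun μ _ => (hd μ).continuousAt.continuousWithinAt) fun μ hμ => ?_
  rw [interior_Icc] at hμ
  rw [(hd μ).deriv]
  have hp := Real.pi_gt_d2
  have hx0 : π / 2 < π * μ / 2 := by nlinarith [hμ.1]
  have hx1 : π * μ / 2 < 5 * π / 6 := by nlinarith [hμ.2]
  have hs1 : 1 / 2 ≤ sin (π * μ / 2 - π / 3) := by
    rw [← sin_pi_div_six]
    exact sin_le_sin_of_le_of_le_pi_div_two (by linarith) (by linarith) (by linarith)
  have hs2 : 1 / 2 ≤ sin (π * μ / 2) := by
    rw [← sin_pi_div_six, ← sin_pi_sub (π * μ / 2)]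
    exact sin_le_sin_of_le_of_le_pi_div_two (by linarith) (by linarith) (by linarith)
  have hc : cos (π * μ / 2 - π / 3) ≤ 9 / 10 := by
    have h1 := sin_sq_add_cos_sq (π * μ / 2 - π / 3)
    nlinarith
  have h4 : 3 / 2 ≤ 3 * μ * sin (π * μ / 2 - π / 3) := by nlinarith [hμ.1]
  nlinarith

theorem abs_sin_sub_taylor_five_le {x : ℝ} (hx : |x| ≤ 1) :
    |sin x - (x - x ^ 3 / 6 + x ^ 5 / 120)| ≤ |x| ^ 7 / 4410 := by
  have hn : ‖(x : ℂ) * Complex.I‖ = |x| := by simp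
  have h := Complex.exp_bound (x := x * Complex.I) (by rwa [hn]) (n := 7) (by norm_num)
  have h2 := (Complex.abs_im_le_norm _).trans h
  rw [hn, Complex.sub_im, Complex.exp_ofReal_mul_I_im] at h2
  have e : (∑ m ∈ Finset.range 7, ((x : ℂ) * Complex.I) ^ m / (m.factorial : ℂ)).im =
      x - x ^ 3 / 6 + x ^ 5 / 120 := by
    have : (∑ m ∈ Finset.range 7, ((x : ℂ) * Complex.I) ^ m / (m.factorial : ℂ)) =
        ((1 - x ^ 2 / 2 + x ^ 4 / 24 - x ^ 6 / 720 : ℝ) : ℂ) +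
          ((x - x ^ 3 / 6 + x ^ 5 / 120 : ℝ) : ℂ) * Complex.I := by
      simp only [Finset.sum_range_succ, Finset.sum_range_zero, Nat.factorial, mul_pow,
        show Complex.I ^ 3 = -Complex.I from Complex.I_pow_three,
        show Complex.I ^ 4 = 1 from Complex.I_pow_four, Complex.I_sq,
        show Complex.I ^ 5 = Complex.I by rw [pow_succ, Complex.I_pow_four, one_mul],
        show Complex.I ^ 6 = -1 by rw [show 6 = 4 + 2 by rfl, pow_add, Complex.I_pow_four,
          Complex.I_sq, one_mul]]
      push_cast
      ring
    rw [this, Complex.add_im, Complex.ofReal_im, Complex.im_ofReal_mul, Complex.I_im, mul_one,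
      zero_add]
  rw [e] at h2
  refine h2.trans (le_of_eq ?_)
  norm_num [Nat.factorial]
  ring

/-- A form with small arguments, suited to Taylor bounds near the zero. -/
theorem grantFactor_eq_sin (μ : ℝ) : grantFactor μ =
    3 * μ * sin (π * (5 / 6 - μ / 2)) - 2 * sin (π * (μ / 2 - 1 / 2)) := by
  have h1 : cos (π * μ / 2 - π / 3) = sin (π * (5 / 6 - μ / 2)) := by
    rw [← cos_pi_div_two_sub]
    ring_nf
  have h2 : cos (π * μ / 2) = -sin (π * (μ / 2 - 1 / 2)) := by
    rw [← sin_neg, ← cos_pi_div_two_sub]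
    ring_nf
  rw [grantFactor, h1, h2]
  ring

theorem grantFactor_lower_pos : 0 < grantFactor 1.4685 := by
  rw [grantFactor_eq_sin]
  have hp1 := Real.pi_gt_d6
  have hp2 := Real.pi_lt_d6
  have h1 : sin (0.31127 : ℝ) ≤ sin (π * (5 / 6 - 1.4685 / 2)) :=
    sin_le_sin_of_le_of_le_pi_div_two (by linarith) (by linarith) (by linarith)
  have h2 : sin (π * (1.4685 / 2 - 1 / 2)) ≤ sin (0.73592 : ℝ) :=
    sin_le_sin_of_le_of_le_pi_div_two (by linarith) (by linarith) (by linarith)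
  have h3 := (abs_le.1 (abs_sin_sub_taylor_five_le (x := 0.31127) (by norm_num))).1
  have h4 := (abs_le.1 (abs_sin_sub_taylor_five_le (x := 0.73592) (by norm_num))).2
  norm_num at h1 h2 h3 h4 ⊢
  linarith

theorem grantFactor_upper_neg : grantFactor 1.4695 < 0 := by
  rw [grantFactor_eq_sin]
  have hp1 := Real.pi_gt_d6
  have hp2 := Real.pi_lt_d6
  have h1 : sin (π * (5 / 6 - 1.4695 / 2)) ≤ sin (0.30971 : ℝ) :=
    sin_le_sin_of_le_of_le_pi_div_two (by linarith) (by linarith) (by linarith)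
  have h2 : sin (0.73748 : ℝ) ≤ sin (π * (1.4695 / 2 - 1 / 2)) :=
    sin_le_sin_of_le_of_le_pi_div_two (by linarith) (by linarith) (by linarith)
  have h3 := (abs_le.1 (abs_sin_sub_taylor_five_le (x := 0.30971) (by norm_num))).2
  have h4 := (abs_le.1 (abs_sin_sub_taylor_five_le (x := 0.73748) (by norm_num))).1
  norm_num at h1 h2 h3 h4 ⊢
  linarith

theorem isGrantRoot_iff_of_lt_two {ν : ℝ} (h0 : 0 < ν) (h2 : ν < 2) :
    IsGrantRoot ν ↔ ν = 2 / 3 ∨ (grantFactor ν = 0 ∧ cos (π * ν / 2 + π / 3) ≠ 0) := by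
  have hp := Real.pi_pos
  have hx0 : 0 < π * ν / 2 := by positivity
  have hx1 : π * ν / 2 < π := by nlinarith
  constructor
  · rintro ⟨h3, h4, h5⟩
    have h6 := grant_mul_cos_cos h3 h4
    rw [h5, zero_mul] at h6
    rcases mul_eq_zero.1 h6.symm with h7 | h7
    · left
      have h8 : cos (π * ν / 2 + π / 6) = cos (π / 2) := by
        rw [cos_pi_div_two]
        linarith
      have h9 : π * ν / 2 + π / 6 = π / 2 := by
        rcases le_or_gt (π * ν / 2 + π / 6) π with h | h
        · exact injOn_cos ⟨by linarith, h⟩ ⟨by linarith, by linarith⟩ h8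
        · exact absurd (h8.trans cos_pi_div_two)
            (cos_neg_of_pi_div_two_lt_of_lt (by linarith) (by linarith)).ne
      have h10 : π * (ν - 2 / 3) = 0 := by linarith
      linarith [(mul_eq_zero.1 h10).resolve_left hp.ne']
    · exact Or.inr ⟨h7, h3⟩
  · have key : ∀ h3 : cos (π * ν / 2 + π / 3) ≠ 0, ∀ h4 : cos (π * ν / 2) ≠ 0,
        2 / 3 * cos (π * ν / 2 + π / 6) * grantFactor ν = 0 → IsGrantRoot ν := by
      intro h3 h4 h5
      refine ⟨h3, h4, ?_⟩
      have h6 := grant_mul_cos_cos h3 h4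
      rw [show 3 * ν * cos (π * ν / 2 - π / 3) + 2 * cos (π * ν / 2) = grantFactor ν from rfl,
        h5] at h6
      exact (mul_eq_zero.1 h6).resolve_right (mul_ne_zero h3 h4)
    rintro (h | ⟨h, h3⟩)
    · have e1 : π * ν / 2 = π / 3 := by rw [h]; ring
      refine key ?_ ?_ ?_
      · rw [e1]
        exact (cos_neg_of_pi_div_two_lt_of_lt (by linarith) (by linarith)).ne
      · rw [e1]
        exact (cos_pos_of_mem_Ioo ⟨by linarith, by linarith⟩).ne'
      · rw [e1, show π / 3 + π / 6 = π / 2 by ring, cos_pi_div_two]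
        ring
    · refine key h3 (fun h4 => ?_) (by rw [h, mul_zero])
      have h5 : π * ν / 2 = π / 2 :=
        injOn_cos ⟨hx0.le, hx1.le⟩ ⟨by linarith, by linarith⟩ (h4.trans cos_pi_div_two.symm)
      have h6 : π * (ν - 1) = 0 := by linarith
      have h7 : ν = 1 := by linarith [(mul_eq_zero.1 h6).resolve_left hp.ne']
      exact (grantFactor_pos_of_le_one h0 h7.le).ne' h

/-- A zero of the second factor in `(2 / 3, 2)` is the second positive root of Grant's equation. -/
theorem grant_conclusion_of_grantFactor_eq_zero {μ : ℝ} (hμ : μ ∈ Set.Ioo (2 / 3 : ℝ) 2)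
    (h : grantFactor μ = 0) :
    IsLeast {ν : ℝ | 0 < ν ∧ IsGrantRoot ν} (2 / 3) ∧
    IsLeast {ν : ℝ | 2 / 3 < ν ∧ IsGrantRoot ν} μ ∧
    |μ - 1.469| < 0.0005 ∧
    μ ≠ 1 := by
  have hp := Real.pi_pos
  have h1 {ν : ℝ} (hν : 0 < ν) (hν0 : grantFactor ν = 0) : 1 < ν := by
    by_contra hc
    exact (grantFactor_pos_of_le_one hν (not_lt.1 hc)).ne' hν0
  have hμ1 := h1 (by linarith [hμ.1]) h
  have hμ53 : μ < 5 / 3 := by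
    by_contra hc
    exact (grantFactor_neg_of_ge (not_lt.1 hc) hμ.2).ne h
  have hμI : μ ∈ Set.Icc (1 : ℝ) (5 / 3) := ⟨hμ1.le, hμ53.le⟩
  have hlow : 1.4685 < μ := by
    refine (grantFactor_strictAntiOn.lt_iff_gt hμI ⟨by norm_num, by norm_num⟩).1 ?_
    rw [h]
    exact grantFactor_lower_pos
  have hup : μ < 1.4695 := by
    refine (grantFactor_strictAntiOn.lt_iff_gt ⟨by norm_num, by norm_num⟩ hμI).1 ?_
    rw [h]
    exact grantFactor_upper_neg
  refine ⟨⟨⟨by norm_num, (isGrantRoot_iff_of_lt_two (by norm_num) (by norm_num)).2 (Or.inl rfl)⟩,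
    ?_⟩, ⟨⟨hμ.1, (isGrantRoot_iff_of_lt_two (by linarith [hμ.1]) hμ.2).2 (Or.inr ⟨h, ?_⟩)⟩, ?_⟩,
    abs_lt.2 ⟨by linarith, by linarith⟩, hμ1.ne'⟩
  · rintro ν ⟨h0, hν⟩
    by_contra hc
    rcases (isGrantRoot_iff_of_lt_two h0 (by linarith)).1 hν with h2 | ⟨h2, -⟩
    · exact hc h2.ge
    · linarith [h1 h0 h2]
  · have hx0 : π / 2 < π * μ / 2 := by nlinarith
    have hx1 : π * μ / 2 < 5 * π / 6 := by nlinarith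
    exact (cos_neg_of_pi_div_two_lt_of_lt (by linarith) (by linarith)).ne
  · rintro ν ⟨h0, hν⟩
    by_contra hc
    rcases (isGrantRoot_iff_of_lt_two (by linarith) (by linarith)).1 hν with h2 | ⟨h2, -⟩
    · linarith
    · have h3 := h1 (by linarith) h2
      exact hc (grantFactor_strictAntiOn.injOn hμI ⟨h3.le, by linarith⟩ (h.trans h2.symm)).le

/-! ### The crest of a solution of Babenko's equation -/

section Crest

variable {φ : ℝ → ℝ} {A B K μ : ℝ}

theorem sq_expansion_of_expansion (hμ : 2 / 3 < μ)
    (hloc : (fun s => φ s - (A * |s| ^ (2 / 3 : ℝ) + B * |s| ^ μ)) =o[𝓝[≠] 0] fun s => |s| ^ μ) :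
    (fun s => φ s ^ 2 - (A ^ 2 * |s| ^ (4 / 3 : ℝ) + 2 * A * B * |s| ^ (μ + 2 / 3)))
      =o[𝓝[≠] 0] fun s => |s| ^ (μ + 2 / 3) := by
  have hμμ : (fun s : ℝ => |s| ^ μ * |s| ^ μ) =o[𝓝[≠] 0] fun s => |s| ^ (μ + 2 / 3) := by
    refine (isLittleO_abs_rpow (by linarith : μ + 2 / 3 < μ + μ)).congr' ?_ EventuallyEq.rfl
    filter_upwards [self_mem_nhdsWithin] with s hs
    rw [Real.rpow_add (abs_pos.2 hs)]
  have h1 := hloc.mul_isBigO (isBigO_refl (fun s : ℝ => |s| ^ (2 / 3 : ℝ)) _)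
  have h2 := hloc.mul_isBigO (isBigO_refl (fun s : ℝ => |s| ^ μ) _)
  have h3 := (hloc.mul hloc).trans hμμ
  have h1' : (fun s : ℝ => |s| ^ μ * |s| ^ (2 / 3 : ℝ)) =ᶠ[𝓝[≠] 0] fun s => |s| ^ (μ + 2 / 3) := by
    filter_upwards [self_mem_nhdsWithin] with s hs
    rw [Real.rpow_add (abs_pos.2 hs)]
  have h4 := ((((h1.congr' EventuallyEq.rfl h1').const_mul_left (2 * A)).add
    ((h2.trans hμμ).const_mul_left (2 * B))).add h3).add (hμμ.const_mul_left (B ^ 2))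
  refine h4.congr' ?_ EventuallyEq.rfl
  filter_upwards [self_mem_nhdsWithin] with s hs
  have hs : 0 < |s| := abs_pos.2 hs
  have e1 : |s| ^ (4 / 3 : ℝ) = |s| ^ (2 / 3 : ℝ) * |s| ^ (2 / 3 : ℝ) := by
    rw [← Real.rpow_add hs]
    norm_num
  rw [e1, Real.rpow_add hs]
  ring

theorem cos_two_thirds : cos (π * (2 / 3) / 2) = 1 / 2 := by
  rw [show π * (2 / 3) / 2 = π / 3 by ring, cos_pi_div_three]

theorem cos_four_thirds : cos (π * (4 / 3) / 2) = -(1 / 2) := by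
  rw [show π * (4 / 3) / 2 = π - π / 3 by ring, cos_pi_sub, cos_pi_div_three]

theorem cos_add_two_thirds_neg (hμ : μ ∈ Set.Ioo (2 / 3 : ℝ) 2) :
    cos (π * (μ + 2 / 3) / 2) < 0 := by
  have := Real.pi_pos
  exact cos_neg_of_pi_div_two_lt_of_lt (by nlinarith [hμ.1]) (by nlinarith [hμ.2])

theorem cos_ne_zero_of_ne_one (hμ : μ ∈ Set.Ioo (2 / 3 : ℝ) 2) (h1 : μ ≠ 1) :
    cos (π * μ / 2) ≠ 0 := by
  have hp := Real.pi_pos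
  intro h
  have h5 : π * μ / 2 = π / 2 :=
    injOn_cos ⟨by nlinarith [hμ.1], by nlinarith [hμ.2]⟩ ⟨by linarith, by linarith⟩
      (h.trans cos_pi_div_two.symm)
  have h6 : π * (μ - 1) = 0 := by linarith
  exact h1 (by linarith [(mul_eq_zero.1 h6).resolve_left hp.ne'])

theorem re_product_eq (hprod : ∀ t > 0, (1 - dnExtension φ t) *
      ((K : ℂ) + 1 / 2 * dnExtension (fun s => φ s ^ 2) t) = K) (t : ℝ) (ht : t > 0) :
    (1 - (dnExtension φ t).re) * (K + (dnExtension (fun s => φ s ^ 2) t).re / 2) +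
      (dnExtension φ t).im * (dnExtension (fun s => φ s ^ 2) t).im / 2 = K := by
  have h := congrArg Complex.re (hprod t ht)
  simp at h
  linarith

/-- The extension of `φ²` in the form used in the matching of coefficients. -/
theorem exists_sq_extension_expansion (hμ : μ ∈ Set.Ioo (2 / 3 : ℝ) 2)
    (hφ2 : IntervalIntegrable (fun s => φ s ^ 2) volume (-π) π)
    (hloc : (fun s => φ s - (A * |s| ^ (2 / 3 : ℝ) + B * |s| ^ μ)) =o[𝓝[≠] 0] fun s => |s| ^ μ) :
    ∃ β : ℝ, (fun t => (dnExtension (fun s => φ s ^ 2) t).re -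
        (β - -(8 / 3 * A ^ 2) * t ^ (1 / 3 : ℝ) -
          2 * A * B * (μ + 2 / 3) / cos (π * (μ + 2 / 3) / 2) * t ^ (μ - 2 / 3 + 1 / 3)))
      =o[𝓝[>] 0] fun t => t ^ (μ - 2 / 3 + 1 / 3) := by
  obtain ⟨β, hβ⟩ := dnExtension_re_expansion hφ2 (by norm_num) (by linarith [hμ.1])
    (by linarith [hμ.2]) (by linarith [hμ.2]) (by linarith [hμ.1])
    (by rw [cos_four_thirds]; norm_num) (cos_add_two_thirds_neg hμ).ne
    (sq_expansion_of_expansion hμ.1 hloc)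
  have e : μ + 2 / 3 - 1 = μ - 2 / 3 + 1 / 3 := by ring
  refine ⟨β, ?_⟩
  rw [e] at hβ
  refine hβ.congr_left fun t => ?_
  rw [cos_four_thirds, show (4 / 3 : ℝ) - 1 = 1 / 3 by norm_num]
  ring

/-- The relation between the second coefficients is Grant's second factor. -/
theorem grantFactor_eq_zero_of_ne_one (hA : 0 < A) (hB : B ≠ 0) (hμ : μ ∈ Set.Ioo (2 / 3 : ℝ) 2)
    (hμ1 : μ ≠ 1) (hφ : IntervalIntegrable φ volume (-π) π)
    (hφ2 : IntervalIntegrable (fun s => φ s ^ 2) volume (-π) π)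
    (hloc : (fun s => φ s - (A * |s| ^ (2 / 3 : ℝ) + B * |s| ^ μ)) =o[𝓝[≠] 0] fun s => |s| ^ μ)
    (hprod : ∀ t > 0, (1 - dnExtension φ t) *
      ((K : ℂ) + 1 / 2 * dnExtension (fun s => φ s ^ 2) t) = K) :
    grantFactor μ = 0 := by
  have hc := cos_ne_zero_of_ne_one hμ hμ1
  have hc' := cos_add_two_thirds_neg hμ
  have hc23 : cos (π * (2 / 3) / 2) ≠ 0 := by rw [cos_two_thirds]; norm_num
  have hc43 : cos (π * (4 / 3) / 2) ≠ 0 := by rw [cos_four_thirds]; norm_num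
  obtain ⟨β, hβ⟩ := exists_sq_extension_expansion hμ hφ2 hloc
  obtain ⟨α, hα⟩ := dnExtension_re_expansion hφ (by norm_num) hμ.1 (by linarith [hμ.2])
    (by linarith [hμ.2]) hμ1 hc23 hc hloc
  have hEi := dnExtension_im_expansion hφ (by norm_num) hμ.1 (by linarith [hμ.2])
    (by linarith [hμ.1]) hμ.2 le_rfl hc23 hc hloc
  have hFi := dnExtension_im_expansion (σ := 4 / 3) hφ2 (by norm_num) (by linarith [hμ.1])
    (by linarith [hμ.2]) (by norm_num) (by norm_num) (by linarith [hμ.1]) hc43 hc'.ne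
    (sq_expansion_of_expansion hμ.1 hloc)
  rw [show (4 / 3 : ℝ) - 1 = 1 / 3 by norm_num] at hFi
  have hα' : (fun t => (dnExtension φ t).re - (α - 4 / 3 * A * t ^ (-(1 / 3) : ℝ) -
      B * μ / cos (π * μ / 2) * t ^ (μ - 1))) =o[𝓝[>] 0] fun t => t ^ (μ - 1) := by
    refine hα.congr_left fun t => ?_
    rw [cos_two_thirds, show (2 / 3 : ℝ) - 1 = -(1 / 3) by norm_num]
    ring
  have hA2 : -(8 / 3 * A ^ 2) ≠ 0 := neg_ne_zero.2 (by positivity)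
  have h := coefficient_relation hμ.1 hμ1 (by positivity : 4 / 3 * A ≠ 0) hA2
    (re_product_eq hprod) hEi hFi hα' hβ
  have h1 : (μ + 2 / 3) * cos (π * μ / 2) - μ * cos (π * (μ + 2 / 3) / 2) = 0 := by
    have hne : A ^ 2 * B ≠ 0 := mul_ne_zero (by positivity) hB
    have key : ∀ p q : ℝ, p ≠ 0 → q ≠ 0 → A ^ 2 * B * ((μ + 2 / 3) * p - μ * q) =
        3 / 8 * (p * q) *
          (4 / 3 * A * (2 * A * B * (μ + 2 / 3) / q) + B * μ / p * -(8 / 3 * A ^ 2)) := by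
      intro p q hp hq
      field_simp
      ring
    have h2 := key _ _ hc hc'.ne
    rw [h, mul_zero] at h2
    exact (mul_eq_zero.1 h2).resolve_left hne
  have e : π * (μ + 2 / 3) / 2 = π * μ / 2 + π / 3 := by ring
  rw [e, cos_add] at h1
  rw [grantFactor, cos_sub]
  rw [cos_pi_div_three, sin_pi_div_three] at *
  linear_combination 3 * h1

/-- The exponent `1` is impossible: the corner `B |s|` produces a logarithm in the first factor that
nothing in the second one can balance. -/
theorem expansion_exponent_ne_one (hA : 0 < A) (hB : B ≠ 0)
    (hφ : IntervalIntegrable φ volume (-π) π)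
    (hφ2 : IntervalIntegrable (fun s => φ s ^ 2) volume (-π) π)
    (hloc : (fun s => φ s - (A * |s| ^ (2 / 3 : ℝ) + B * |s| ^ μ)) =o[𝓝[≠] 0] fun s => |s| ^ μ)
    (hprod : ∀ t > 0, (1 - dnExtension φ t) *
      ((K : ℂ) + 1 / 2 * dnExtension (fun s => φ s ^ 2) t) = K) :
    μ ≠ 1 := by
  rintro rfl
  have hμ : (1 : ℝ) ∈ Set.Ioo (2 / 3 : ℝ) 2 := ⟨by norm_num, by norm_num⟩
  have hc23 : cos (π * (2 / 3) / 2) ≠ 0 := by rw [cos_two_thirds]; norm_num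
  have hc43 : cos (π * (4 / 3) / 2) ≠ 0 := by rw [cos_four_thirds]; norm_num
  have hc56 := cos_ne_zero_of_ne_one (μ := 5 / 6) ⟨by norm_num, by norm_num⟩ (by norm_num)
  obtain ⟨β, hβ⟩ := exists_sq_extension_expansion hμ hφ2 hloc
  -- the coarser exponent `5 / 6` avoids the logarithm where only leading terms are needed
  have hweak : (fun s => φ s - (A * |s| ^ (2 / 3 : ℝ) + 0 * |s| ^ (5 / 6 : ℝ))) =o[𝓝[≠] 0]
      fun s => |s| ^ (5 / 6 : ℝ) := by
    have h1 : (fun s : ℝ => |s| ^ (1 : ℝ)) =o[𝓝[≠] 0] fun s => |s| ^ (5 / 6 : ℝ) :=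
      isLittleO_abs_rpow (by norm_num)
    refine ((hloc.trans h1).add (h1.const_mul_left B)).congr_left fun s => ?_
    ring
  have hEi := dnExtension_im_expansion hφ (by norm_num) (by norm_num) (by norm_num) (by norm_num)
    (by norm_num) le_rfl hc23 hc56 hweak
  have hFi := dnExtension_im_expansion hφ2 (by norm_num) (by norm_num) (by norm_num) (by norm_num)
    (by norm_num) le_rfl hc43 (cos_add_two_thirds_neg hμ).ne
    (sq_expansion_of_expansion hμ.1 hloc)
  have hIm : (fun t => (dnExtension φ t).im * (dnExtension (fun s => φ s ^ 2) t).im) =o[𝓝[>] 0]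
      fun t => t ^ (1 / 3 : ℝ) := by
    refine ((hEi.mul hFi).congr' EventuallyEq.rfl ?_).trans
      (isLittleO_rpow_nhdsGT_zero (by norm_num : (1 / 3 : ℝ) < 1 / 2))
    filter_upwards [self_mem_nhdsWithin] with t ht
    rw [← Real.rpow_add ht]
    norm_num
  obtain ⟨r, hr, hrl, hre⟩ := exists_sub_model hφ A (by norm_num) hc23
  have hre' : (fun t => (dnExtension φ t).re - (dnExtension r t).re +
      4 / 3 * A * t ^ (-(1 / 3) : ℝ)) =O[𝓝[>] 0] fun _ => (1 : ℝ) := by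
    have h0 : (fun t : ℝ => t ^ (2 / 3 + 1 : ℝ)) =o[𝓝[>] 0] fun _ => (1 : ℝ) :=
      (isLittleO_one_iff ℝ).2 (tendsto_rpow_nhdsGT_zero (by norm_num))
    refine ((isLittleO_re (hre.trans_isLittleO h0)).congr_left fun t => ?_).isBigO
    simp only [Complex.sub_re, Complex.ofReal_re]
    rw [cos_two_thirds, show (2 / 3 : ℝ) - 1 = -(1 / 3) by norm_num]
    ring
  obtain ⟨α, hα⟩ := dnExtension_re_expansion hφ (by norm_num) (by norm_num) (by norm_num)
    (by norm_num) (by norm_num) hc23 hc56 hweak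
  have hpt : Tendsto (fun t => t ^ (1 / 3 : ℝ) * (1 - (dnExtension φ t).re)) (𝓝[>] 0)
      (𝓝 (4 / 3 * A)) := by
    have h1 := ((isBigO_refl (fun t : ℝ => t ^ (1 / 3 : ℝ)) (𝓝[>] 0)).mul_isLittleO
      hα).const_mul_left (-1)
    have h2 : Tendsto (fun t : ℝ => t ^ (1 / 3 : ℝ) * t ^ (5 / 6 - 1 : ℝ)) (𝓝[>] 0) (𝓝 0) := by
      refine (tendsto_rpow_nhdsGT_zero (by norm_num : (0 : ℝ) < 1 / 6)).congr' ?_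
      filter_upwards [self_mem_nhdsWithin] with t ht
      rw [← Real.rpow_add ht]
      norm_num
    have h3 := ((h1.isBigO.trans_tendsto h2).add
      ((tendsto_rpow_nhdsGT_zero (by norm_num : (0 : ℝ) < 1 / 3)).const_mul (1 - α))).const_add
        (4 / 3 * A)
    simp only [mul_zero, add_zero] at h3
    refine h3.congr' ?_
    filter_upwards [self_mem_nhdsWithin] with t ht
    have ht : 0 < t := ht
    have h4 : t ^ (1 / 3 : ℝ) * t ^ (2 / 3 - 1 : ℝ) = 1 := by
      rw [← Real.rpow_add ht]
      norm_num
    rw [cos_two_thirds]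
    linear_combination (-(4 / 3 * A)) * h4
  have hbdd := first_factor_isBigO_one (by positivity : 4 / 3 * A ≠ 0)
    (neg_ne_zero.2 (by positivity : 8 / 3 * A ^ 2 ≠ 0)) (re_product_eq hprod) hIm hpt
    (by norm_num at hβ ⊢; exact hβ)
  refine not_isBigO_one_dnExtension_re hr hB ?_ (((hbdd.add hre').sub
    (isBigO_refl (fun _ => (1 : ℝ)) _)).neg_left.congr_left fun t => ?_)
  · have h1 : (fun s : ℝ => |s| ^ (2 / 3 + 2 : ℝ)) =o[𝓝[≠] 0] fun s => |s| ^ (1 : ℝ) :=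
      isLittleO_abs_rpow (by norm_num)
    have h2 := (hrl.trans_isLittleO h1).add hloc
    simp only [Real.rpow_one] at h2
    refine h2.congr_left fun s => ?_
    ring
  · ring

end Crest

theorem theorem2 (c A B μ : ℝ) (η : Torus → ℝ)
    (hA : 0 < A) (hB : B ≠ 0) (hμ : μ ∈ Set.Ioo (2 / 3 : ℝ) 2)
    (hη : IsBabenkoSolution c η)
    (hloc : (fun u : ℝ => η (u : Torus) -
        (c ^ 2 / 2 - A * |u| ^ (2 / 3 : ℝ) - B * |u| ^ μ))
      =o[𝓝[≠] (0 : ℝ)] (fun u : ℝ => |u| ^ μ)) :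
    IsLeast {ν : ℝ | 0 < ν ∧ IsGrantRoot ν} (2 / 3) ∧
    IsLeast {ν : ℝ | 2 / 3 < ν ∧ IsGrantRoot ν} μ ∧
    |μ - 1.469| < 0.0005 ∧
    μ ≠ 1 := by
  obtain ⟨v, w, ⟨hφ, -⟩, ⟨hφ2, -⟩, -⟩ := hη.exists_crest_form
  have hφi := intervalIntegrable_coe_of_integrable (hφ.integrable one_le_two)
  have hφ2i := intervalIntegrable_coe_of_integrable (hφ2.integrable one_le_two)
  have hprod : ∀ t > 0, (1 - dnExtension (fun s => c ^ 2 / 2 - η s) t) *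
      (((c ^ 2 / 2 : ℝ) : ℂ) + 1 / 2 * dnExtension (fun s => (c ^ 2 / 2 - η s) ^ 2) t) =
        ((c ^ 2 / 2 : ℝ) : ℂ) := fun t ht => hη.mul_dnExtension_eq ht
  have hloc' : (fun s : ℝ => c ^ 2 / 2 - η s - (A * |s| ^ (2 / 3 : ℝ) + B * |s| ^ μ))
      =o[𝓝[≠] 0] fun s => |s| ^ μ := by
    refine hloc.neg_left.congr_left fun s => ?_
    ring
  have hμ1 := expansion_exponent_ne_one hA hB hφi hφ2i hloc' hprod
  exact grant_conclusion_of_grantFactor_eq_zero hμ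
    (grantFactor_eq_zero_of_ne_one hA hB hμ hμ1 hφi hφ2i hloc' hprod)
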